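/- **Theorem.** Write $\mathbb{Z}_-=\{\dots,-1,0\}$ and equip $(\mathbb{R}^n)^{\mathbb{Z}_-}$ with the product $\sigma$-algebra. A *reservoir system* is a pair of maps $F:\mathbb{R}^N\times\mathbb{R}^n\to\mathbb{R}^N$, $h:\mathbb{R}^N\to\mathbb{R}$, with equations $x_t=F(x_{t-1},z_t)$, $y_t=h(x_t)$, $t\in\mathbb{Z}$. It has the *echo state property* if for every input $z\in(\mathbb{R}^n)^{\mathbb{Z}}$ there is exactly one $x\in(\mathbb{R}^N)^{\mathbb{Z}}$ satisfying the first equation for all $t\in\mathbb{Z}$; its *filter* is then $U(z):=y$. A filter $U$ is *causal* if $U(z)_t=U(w)_t$ whenever $z_\tau=w_\tau$ for all $\tau\le t$, and *time-invariant* if it commutes with all time shifts. The *functional* of a causal filter is $H^{RC}(z):=U(z^e)_0$ for $z\in(\mathbb{R}^n)^{\mathbb{Z}_-}$, where $z^e\in(\mathbb{R}^n)^{\mathbb{Z}}$ is any extension of $z$. Let $p\in[1,\infty)$, let $H:(\mathbb{R}^n)^{\mathbb{Z}_-}\to\mathbb{R}$ be measurable, let $\mu$ be a probability measure on $(\mathbb{R}^n)^{\mathbb{Z}_-}$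 with $H\in L^p(\mu)$, and let $\varepsilon>0$. Then there is a reservoir system which has the echo state property, whose filter is causal and time-invariant, and whose functional $H^{RC}$ is measurable and satisfies $$H^{RC}\in L^p(\mu),\qquad \|H-H^{RC}\|_{L^p(\mu)}<\varepsilon .$$ Moreover, the system can be chosen in each of the following families: 1. *Linear reservoirs with polynomial readout*, $x_t=Ax_{t-1}+cz_t$, $y_t=h(x_t)$, for some $N\in\mathbb{N}$, $A\in\mathbb{R}^{N\times N}$, $c\in\mathbb{R}^{N\times n}$ and a real polynomial $h$ in $N$ variables, provided that for every $K\in\mathbb{N}$ there is $\alpha>0$ with $\int\exp\big(\alpha\sum_{k=0}^K\sum_{i=1}^n|z^{(i)}_{-k}|\big)\,\mu(dz)<\infty$. 2. *Linear reservoirs with neural network readout*, $x_t=Ax_{t-1}+cz_t$, $y_t=h(x_t)$, for some $N\in\mathbb{N}$, $A\in\mathbb{R}^{N\times N}$, $c\in\mathbb{R}^{N\times n}$ and $h(x)=\sum_{j=1}^k\beta_j\,\sigma(\alpha_j\cdot x-\theta_j)$ with $k\in\mathbb{N}$, $\beta_j,\theta_j\in\mathbb{R}$, $\alpha_j\in\mathbb{R}^N$;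 here $\sigma:\mathbb{R}\to\mathbb{R}$ is any given bounded measurable function that is not Lebesgue-almost everywhere equal to a constant. 3. *Trigonometric state-affine systems with linear readout*, $x_t=P(z_t)x_{t-1}+Q(z_t)$, $y_t=W^\top x_t$, for some $N\in\mathbb{N}$, $W\in\mathbb{R}^N$ and trigonometric polynomials $P,Q$ on $\mathbb{R}^n$ with values in $\mathbb{R}^{N\times N}$ and $\mathbb{R}^{N\times 1}$ respectively, that is, finite sums $\sum_{k=1}^r\big(A_k\cos(u_k\cdot z)+B_k\sin(v_k\cdot z)\big)$ with real matrices $A_k,B_k$ of the respective size and $u_k,v_k\in\mathbb{R}^n$. 4. *Echo state networks with linear readout*, $x_t=\sigma(Ax_{t-1}+Cz_t+\zeta)$ with $\sigma$ applied componentwise, $y_t=W^\top x_t$, for some $N\in\mathbb{N}$, $A\in\mathbb{R}^{N\times N}$, $C\in\mathbb{R}^{N\times n}$, $\zeta,W\in\mathbb{R}^N$; here $\sigma:\mathbb{R}\to\mathbb{R}$ is any given bounded, continuous, non-constant function. -/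

import Mathlib

open MeasureTheory
open scoped ENNReal Matrix

/-- The nonpositive integers `ℤ₋ = {…, -1, 0}`. -/
abbrev NonposInt : Type := {t : ℤ // t ≤ 0}

/-- Bi-infinite input sequences `(ℝⁿ)^ℤ`. -/
abbrev Signal (n : ℕ) : Type := ℤ → Fin n → ℝ

/-- The path space `(ℝⁿ)^{ℤ₋}`; its measurable structure is the product `σ`-algebra. -/
abbrev PastPath (n : ℕ) : Type := NonposInt → Fin n → ℝ

/-- The point `-k` of `ℤ₋`, for `k : ℕ`. -/
def NonposInt.ofNeg (k : ℕ) : NonposInt := ⟨-(k : ℤ), by omega⟩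

/-- The time delay operator `T_{-τ}`, given by `(T_{-τ} z)_t = z_{t+τ}`. -/
def timeDelay {α : Type*} (τ : ℤ) (z : ℤ → α) : ℤ → α := fun t => z (t + τ)

/-- A filter `(ℝⁿ)^ℤ → ℝ^ℤ` is causal if its output at time `t` depends only on the input
up to time `t`. -/
def IsCausal {n : ℕ} (U : Signal n → ℤ → ℝ) : Prop :=
  ∀ (z w : Signal n) (t : ℤ), (∀ τ ≤ t, z τ = w τ) → U z t = U w t

/-- A filter is time-invariant if it commutes with all time delay operators. -/
def IsTimeInvariant {n : ℕ} (U : Signal n → ℤ → ℝ) : Prop :=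
  ∀ (τ : ℤ) (z : Signal n), timeDelay τ (U z) = U (timeDelay τ z)

/-- An extension of a path on `ℤ₋` to a sequence on `ℤ` (by zero at positive times). -/
def PastPath.extend {n : ℕ} (z : PastPath n) : Signal n :=
  fun t => if h : t ≤ 0 then z ⟨t, h⟩ else 0

/-- The functional `H_U(z) = U(zᵉ)_0` of a filter `U`. For causal `U` the choice of the
extension `zᵉ` is immaterial, see `functionalOf_eq`. -/
def functionalOf {n : ℕ} (U : Signal n → ℤ → ℝ) : PastPath n → ℝ :=
  fun z => U z.extend 0

theorem functionalOf_eq {n : ℕ} {U : Signal n → ℤ → ℝ} (hU : IsCausal U) (z : PastPath n)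
    (w : Signal n) (hw : ∀ t : NonposInt, w t = z t) : functionalOf U z = U w 0 := by
  refine hU _ _ 0 fun τ hτ => ?_
  simp only [PastPath.extend, hτ, dif_pos]
  exact (hw ⟨τ, hτ⟩).symm

/-- A reservoir system with inputs in `ℝⁿ` and states in `ℝᴺ`:
`x_t = F(x_{t-1}, z_t)`, `y_t = h(x_t)`. -/
structure ReservoirSystem (n N : ℕ) where
  /-- the reservoir map -/
  F : (Fin N → ℝ) → (Fin n → ℝ) → (Fin N → ℝ)
  /-- the readout map -/
  h : (Fin N → ℝ) → ℝ

namespace ReservoirSystem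

variable {n N : ℕ}

/-- `x` is a state sequence for the input `z`. -/
def IsSolution (S : ReservoirSystem n N) (z : Signal n) (x : ℤ → Fin N → ℝ) : Prop :=
  ∀ t : ℤ, x t = S.F (x (t - 1)) (z t)

/-- The echo state property: every input has exactly one state sequence. -/
def EchoStateProperty (S : ReservoirSystem n N) : Prop :=
  ∀ z : Signal n, ∃! x : ℤ → Fin N → ℝ, S.IsSolution z x

/-- The filter of a reservoir system with the echo state property: it maps an input to the
output of its unique state sequence. -/
noncomputable def filter (S : ReservoirSystem n N) (hS : S.EchoStateProperty) :
    Signal n → ℤ → ℝ :=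
  fun z t => S.h ((hS z).choose t)

/-- The reservoir functional of a reservoir system with the echo state property. -/
noncomputable def functional (S : ReservoirSystem n N) (hS : S.EchoStateProperty) :
    PastPath n → ℝ :=
  functionalOf (S.filter hS)

/-- `S` has the echo state property, its filter is causal and time-invariant, its functional is
measurable and belongs to `L^p(μ)`, and it is at `L^p(μ)`-distance less than `ε` from `H`. -/
def Approximates (S : ReservoirSystem n N) (H : PastPath n → ℝ) (p : ℝ≥0∞)
    (μ : Measure (PastPath n)) (ε : ℝ) : Prop :=
  ∃ hS : S.EchoStateProperty,
    IsCausal (S.filter hS) ∧ IsTimeInvariant (S.filter hS) ∧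
    Measurable (S.functional hS) ∧ MemLp (S.functional hS) p μ ∧
    eLpNorm (fun z => H z - S.functional hS z) p μ < ENNReal.ofReal ε

/-- The linear reservoir `x_t = A x_{t-1} + c z_t` with readout `y_t = h(x_t)`. -/
def linear (A : Matrix (Fin N) (Fin N) ℝ) (c : Matrix (Fin N) (Fin n) ℝ)
    (h : (Fin N → ℝ) → ℝ) : ReservoirSystem n N where
  F x z := A *ᵥ x + c *ᵥ z
  h := h

/-- The state-affine system `x_t = P(z_t) x_{t-1} + Q(z_t)` with linear readout `y_t = Wᵀ x_t`;
`Q` takes values in the `N × 1` matrices. -/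
def stateAffine (W : Fin N → ℝ) (P : (Fin n → ℝ) → Matrix (Fin N) (Fin N) ℝ)
    (Q : (Fin n → ℝ) → Matrix (Fin N) (Fin 1) ℝ) : ReservoirSystem n N where
  F x z := P z *ᵥ x + fun i => Q z i 0
  h x := W ⬝ᵥ x

/-- The echo state network `x_t = σ(A x_{t-1} + C z_t + ζ)`, with `σ` applied componentwise, and
linear readout `y_t = Wᵀ x_t`. -/
def echoStateNetwork (σ : ℝ → ℝ) (A : Matrix (Fin N) (Fin N) ℝ) (C : Matrix (Fin N) (Fin n) ℝ)
    (ζ W : Fin N → ℝ) : ReservoirSystem n N where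
  F x z := fun i => σ ((A *ᵥ x + C *ᵥ z + ζ) i)
  h x := W ⬝ᵥ x

end ReservoirSystem

/-- One-hidden-layer feedforward neural networks with activation function `σ`:
`h(x) = ∑ⱼ βⱼ σ(αⱼ · x - θⱼ)`. -/
def IsNeuralNetwork {N : ℕ} (σ : ℝ → ℝ) (h : (Fin N → ℝ) → ℝ) : Prop :=
  ∃ (k : ℕ) (β θ : Fin k → ℝ) (α : Fin k → Fin N → ℝ),
    ∀ x : Fin N → ℝ, h x = ∑ j, β j * σ (α j ⬝ᵥ x - θ j)

/-- Matrix-valued trigonometric polynomials on `ℝⁿ`: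
`R(z) = ∑ₖ (Aₖ cos(uₖ · z) + Bₖ sin(vₖ · z))`. -/
def IsTrigPolynomial {n N M : ℕ} (R : (Fin n → ℝ) → Matrix (Fin N) (Fin M) ℝ) : Prop :=
  ∃ (r : ℕ) (A B : Fin r → Matrix (Fin N) (Fin M) ℝ) (u v : Fin r → Fin n → ℝ),
    ∀ z : Fin n → ℝ,
      R z = ∑ k, (Real.cos (u k ⬝ᵥ z) • A k + Real.sin (v k ⬝ᵥ z) • B k)

/-- For every `K` there is `α > 0` such that
`∫ exp(α ∑_{k=0}^K ∑_{i=1}^n |z_{-k}^{(i)}|) μ(dz) < ∞`. -/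
def HasExponentialMoments {n : ℕ} (μ : Measure (PastPath n)) : Prop :=
  ∀ K : ℕ, ∃ α : ℝ, 0 < α ∧
    Integrable (fun z : PastPath n =>
      Real.exp (α * ∑ k ∈ Finset.range (K + 1), ∑ i, |z (NonposInt.ofNeg k) i|)) μ

/-! The problem splits into a density statement in `L^p(μ)` for functions of finitely many past
inputs, and an exact realisation of the dense functions by reservoirs.

Density goes through cosine waves. Given a space `V` of `L^p` functions, the bounded measurable
functions that multiply `V` into its `L^p` closure form an algebra (`lpMultiplier`) that is stable
under bounded pointwise limits, so the sets whose indicators it contains form a σ-algebra. For `V`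
spanned by the waves `cos (ℓ + φ)`, with `ℓ` linear in finitely many coordinates, this σ-algebra
contains all half-spaces, hence all measurable sets, and the waves are dense
(`mem_lpClosure_trigSpan`). It remains to approximate single waves. For polynomials, exponential
moments dominate the Taylor series of `cos ℓ` and `sin ℓ` when `ℓ` is small, and the angle addition
formulas inside the multiplier algebra reach all frequencies
(`cos_mem_lpClosure_polynomialAlgebra`). For networks, averages of `σ` over translations and
dilations stay in the closure. They produce a nonzero integrable limit `h`; convolving `h` with a
cosine, at a frequency where the Fourier transform of `h` does not vanish, returns a wave of that
frequency (`isNetworkLimit_cos`).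

All reservoirs are finite cascades: each state component is driven only by components of smaller
rank (`IsRanked`), so the state is a function of finitely many inputs, and no contraction argument
is needed for the echo state property. A shift register stores the last inputs for the linear
reservoirs. A cascade of rotations accumulates the phase of a wave for the state-affine systems. An
echo state network passes every stored value through `σ`; its delay line consists of networks close
to the identity (`exists_network_iterate_tendsto_id`), and the distortion disappears in the limit by
dominated convergence. -/

open Filter Topology

/-! ### Closures of function spaces in `L^p` -/

section LpClosure

variable {Ω : Type*} [MeasurableSpace Ω]

/-- The functions in `L^p(μ)` that are `L^p(μ)`-limits of elements of `V`. -/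
def lpClosure (p : ℝ≥0∞) [hp : Fact (1 ≤ p)] (μ : Measure Ω) (V : Submodule ℝ (Ω → ℝ)) :
    Submodule ℝ (Ω → ℝ) where
  carrier := {f | MemLp f p μ ∧ ∀ ε : ℝ≥0∞, ε ≠ 0 → ∃ g ∈ V, MemLp g p μ ∧ eLpNorm (f - g) p μ ≤ ε}
  zero_mem' := ⟨MemLp.zero, fun ε _ => ⟨0, V.zero_mem, MemLp.zero, by simp⟩⟩
  add_mem' := by
    rintro f f' ⟨hf, hf'⟩ ⟨hg, hg'⟩
    refine ⟨hf.add hg, fun ε hε => ?_⟩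
    have hε2 : ε / 2 ≠ 0 := by simpa using hε
    obtain ⟨u, hu, hum, hu'⟩ := hf' _ hε2
    obtain ⟨v, hv, hvm, hv'⟩ := hg' _ hε2
    refine ⟨u + v, V.add_mem hu hv, hum.add hvm, ?_⟩
    rw [show f + f' - (u + v) = (f - u) + (f' - v) by abel]
    refine (eLpNorm_add_le (hf.sub hum).1 (hg.sub hvm).1 hp.out).trans ?_
    exact (add_le_add hu' hv').trans_eq (ENNReal.add_halves ε)
  smul_mem' := by
    rintro c f ⟨hf, hf'⟩
    refine ⟨hf.const_smul c, fun ε hε => ?_⟩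
    obtain ⟨u, hu, hum, hu'⟩ := hf' (ε / (‖c‖ₑ + 1)) (by simp [hε])
    refine ⟨c • u, V.smul_mem c hu, hum.const_smul c, ?_⟩
    rw [← smul_sub, eLpNorm_const_smul]
    calc ‖c‖ₑ * eLpNorm (f - u) p μ ≤ (‖c‖ₑ + 1) * (ε / (‖c‖ₑ + 1)) := by gcongr; simp
      _ = ε := ENNReal.mul_div_cancel (by simp) (by simp)

variable {p : ℝ≥0∞} [hp : Fact (1 ≤ p)] {μ : Measure Ω} {V : Submodule ℝ (Ω → ℝ)}

theorem mem_lpClosure_of_mem {f : Ω → ℝ} (hf : f ∈ V) (hfm : MemLp f p μ) :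
    f ∈ lpClosure p μ V :=
  ⟨hfm, fun ε _ => ⟨f, hf, hfm, by simp⟩⟩

theorem mem_lpClosure_of_forall_exists {f : Ω → ℝ} (hf : MemLp f p μ)
    (h : ∀ ε : ℝ≥0∞, ε ≠ 0 → ∃ g ∈ lpClosure p μ V, eLpNorm (f - g) p μ ≤ ε) :
    f ∈ lpClosure p μ V := by
  refine ⟨hf, fun ε hε => ?_⟩
  have hε2 : ε / 2 ≠ 0 := by simpa using hε
  obtain ⟨g, hg, hfg⟩ := h _ hε2
  obtain ⟨u, hu, hum, hgu⟩ := hg.2 _ hε2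
  refine ⟨u, hu, hum, ?_⟩
  rw [show f - u = (f - g) + (g - u) by abel]
  refine (eLpNorm_add_le (hf.sub hg.1).1 (hg.1.sub hum).1 hp.out).trans ?_
  exact (add_le_add hfg hgu).trans_eq (ENNReal.add_halves ε)

theorem mem_lpClosure_of_tendsto {f : Ω → ℝ} (hf : MemLp f p μ) {g : ℕ → Ω → ℝ}
    (hg : ∀ m, g m ∈ lpClosure p μ V)
    (h : Tendsto (fun m => eLpNorm (g m - f) p μ) atTop (𝓝 0)) : f ∈ lpClosure p μ V := by
  refine mem_lpClosure_of_forall_exists hf fun ε hε => ?_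
  obtain ⟨m, hm⟩ := (h.eventually (gt_mem_nhds (pos_iff_ne_zero.2 hε))).exists
  exact ⟨g m, hg m, by rw [eLpNorm_sub_comm]; exact hm.le⟩

theorem mem_lpClosure_of_ae_eq {f g : Ω → ℝ} (hf : f ∈ lpClosure p μ V) (h : f =ᵐ[μ] g) :
    g ∈ lpClosure p μ V := by
  refine mem_lpClosure_of_forall_exists (hf.1.ae_eq h) fun ε _ => ⟨f, hf, ?_⟩
  rw [eLpNorm_congr_ae (g := 0) (by filter_upwards [h] with x hx; simp [hx])]
  simp

/-- Composition with `X` is an isometry from `L^p` of the law of `X` into `L^p(μ)`. This carries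
univariate approximation results over to path space. -/
theorem lpClosure_comp {Ω' : Type*} [MeasurableSpace Ω'] {X : Ω → Ω'} (hX : Measurable X)
    {V' : Submodule ℝ (Ω' → ℝ)} (hV : ∀ g ∈ V', g ∘ X ∈ V) {f : Ω' → ℝ}
    (hf : f ∈ lpClosure p (μ.map X) V') : f ∘ X ∈ lpClosure p μ V := by
  refine ⟨hf.1.comp_of_map hX.aemeasurable, fun ε hε => ?_⟩
  obtain ⟨g, hg, hgm, hfg⟩ := hf.2 ε hε
  refine ⟨g ∘ X, hV g hg, hgm.comp_of_map hX.aemeasurable, ?_⟩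
  rwa [eLpNorm_map_measure (hf.1.sub hgm).1 hX.aemeasurable] at hfg

/-- Dominated convergence in `L^p`. -/
theorem tendsto_eLpNorm_sub_of_dominated (hp_top : p ≠ ∞) {f G : Ω → ℝ} {g : ℕ → Ω → ℝ}
    (hg : ∀ m, AEStronglyMeasurable (g m) μ) (hG : MemLp G p μ) (hgG : ∀ m x, |g m x| ≤ G x)
    (h : ∀ x, Tendsto (fun m => g m x) atTop (𝓝 (f x))) :
    MemLp f p μ ∧ Tendsto (fun m => eLpNorm (g m - f) p μ) atTop (𝓝 0) := by
  have hp0 : p ≠ 0 := (zero_lt_one.trans_le hp.out).ne'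
  have hp0' : 0 < p.toReal := ENNReal.toReal_pos hp0 hp_top
  have hfm : AEStronglyMeasurable f μ :=
    aestronglyMeasurable_of_tendsto_ae _ hg (Eventually.of_forall h)
  have hfG : ∀ x, |f x| ≤ G x := fun x =>
    le_of_tendsto ((h x).abs) (Eventually.of_forall fun m => hgG m x)
  have hf : MemLp f p μ := hG.mono' hfm (Eventually.of_forall hfG)
  refine ⟨hf, ?_⟩
  have h2G : MemLp (fun x => 2 * G x) p μ := hG.const_mul 2
  have key : Tendsto (fun m => ∫⁻ x, ‖(g m - f) x‖ₑ ^ p.toReal ∂μ) atTop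
      (𝓝 (∫⁻ _, 0 ∂μ)) := by
    refine tendsto_lintegral_of_dominated_convergence' (fun x => ‖2 * G x‖ₑ ^ p.toReal)
      (fun m => (((hg m).sub hfm).enorm.pow_const _)) (fun m => Eventually.of_forall fun x => ?_)
      ?_ (Eventually.of_forall fun x => ?_)
    · refine ENNReal.rpow_le_rpow (enorm_le_iff_norm_le.2 ?_) hp0'.le
      have h1 := abs_le.1 (hgG m x)
      have h2 := abs_le.1 (hfG x)
      simp only [Pi.sub_apply, Real.norm_eq_abs]
      exact abs_le_abs (by linarith) (by linarith)
    · exact ((eLpNorm_lt_top_iff_lintegral_rpow_enorm_lt_top hp0 hp_top).1 h2G.2).ne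
    · have h1 : Tendsto (fun m => ‖(g m - f) x‖ₑ) atTop (𝓝 0) := by
        have := ((h x).sub_const (f x)).enorm
        simpa using this
      have := (ENNReal.continuous_rpow_const (y := p.toReal)).continuousAt.tendsto.comp h1
      simpa [Function.comp_def, ENNReal.zero_rpow_of_pos hp0'] using this
  simp only [eLpNorm_eq_lintegral_rpow_enorm_toReal hp0 hp_top]
  have := (ENNReal.continuous_rpow_const (y := 1 / p.toReal)).continuousAt.tendsto.comp key
  simpa [Function.comp_def, ENNReal.zero_rpow_of_pos (inv_pos.2 hp0')] using this

theorem mem_lpClosure_of_dominated (hp_top : p ≠ ∞) {f G : Ω → ℝ} {g : ℕ → Ω → ℝ}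
    (hg : ∀ m, g m ∈ lpClosure p μ V) (hG : MemLp G p μ) (hgG : ∀ m x, |g m x| ≤ G x)
    (h : ∀ x, Tendsto (fun m => g m x) atTop (𝓝 (f x))) : f ∈ lpClosure p μ V :=
  have := tendsto_eLpNorm_sub_of_dominated hp_top (fun m => (hg m).1.1) hG hgG h
  mem_lpClosure_of_tendsto this.1 hg this.2

/-- The quotient map by `S` is continuous and linear, so it commutes with the integral, and it
annihilates the integrand. A non-integrable `f` has integral `0` by convention. -/
theorem Submodule.integral_mem_of_isClosed {α E : Type*} [MeasurableSpace α] {κ : Measure α}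
    [NormedAddCommGroup E] [NormedSpace ℝ E] [CompleteSpace E] (S : Submodule ℝ E)
    (hS : IsClosed (S : Set E)) {f : α → E} (hf : ∀ a, f a ∈ S) : ∫ a, f a ∂κ ∈ S := by
  by_cases hfi : Integrable f κ
  · have : IsClosed (S : Set E) := hS
    have h := (S.mkQL).integral_comp_comm hfi
    refine (Submodule.Quotient.mk_eq_zero S).1 (h.symm.trans ?_)
    exact integral_eq_zero_of_ae (Eventually.of_forall fun a =>
      (Submodule.Quotient.mk_eq_zero S).2 (hf a))
  · rw [integral_undef hfi]; exact S.zero_mem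

/-- An open set is a countable union of balls with centres in a dense sequence and rational radii.
This reduces measurability of an `L^p`-valued map to that of scalar distances. -/
theorem measurable_of_forall_dist {α E : Type*} [MeasurableSpace α] [PseudoMetricSpace E]
    [SecondCountableTopology E] [MeasurableSpace E] [BorelSpace E] {f : α → E}
    (h : ∀ u : E, Measurable fun a => dist (f a) u) : Measurable f := by
  obtain ⟨d, hdc, hd⟩ := TopologicalSpace.exists_countable_dense E
  refine measurable_of_isOpen fun U hU => ?_
  have : f ⁻¹' U = ⋃ u ∈ d, ⋃ q ∈ {q : ℚ | Metric.ball u (q : ℝ) ⊆ U},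
      {a | dist (f a) u < (q : ℝ)} := by
    ext a
    simp only [Set.mem_preimage, Set.mem_iUnion, Set.mem_ofPred_eq, exists_prop]
    constructor
    · intro ha
      obtain ⟨r, hr, hrU⟩ := Metric.isOpen_iff.1 hU _ ha
      obtain ⟨q, hq0, hqr⟩ := exists_rat_btwn (half_pos hr)
      obtain ⟨u, hu, hud⟩ := hd.exists_dist_lt (f a) hq0
      refine ⟨u, hu, q, fun y hy => hrU ?_, hud⟩
      have h1 : dist y u < q := hy
      have h2 := dist_triangle_right y (f a) u
      rw [Metric.mem_ball]; linarith
    · rintro ⟨u, -, q, hq, haq⟩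
      exact hq haq
  rw [this]
  refine MeasurableSet.biUnion hdc fun u _ => MeasurableSet.biUnion (Set.to_countable _)
    fun q _ => ?_
  exact measurableSet_lt (h u) measurable_const

/-- Averages over a parameter of elements of the closure stay in the closure. -/
theorem integral_mem_lpClosure [IsFiniteMeasure μ] [MeasurableSpace.CountablyGenerated Ω]
    (hp_top : p ≠ ∞)
    {F : ℝ → Ω → ℝ} (hF : Measurable (Function.uncurry F)) {B : ℝ} (hB : ∀ y x, |F y x| ≤ B)
    (hFV : ∀ y, F y ∈ lpClosure p μ V) {k : ℝ → ℝ} (hk : Integrable k) :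
    (fun x => ∫ y, F y x * k y) ∈ lpClosure p μ V := by
  have : Fact (p ≠ ∞) := ⟨hp_top⟩
  have hp0 : p ≠ 0 := (zero_lt_one.trans_le hp.out).ne'
  have hFm : ∀ y, Measurable (F y) := fun y => hF.comp measurable_prodMk_left
  -- The closure of `V`, seen as a closed subspace of the Banach space `Lp`, so that a Bochner
  -- integral of its elements remains inside.
  let S : Submodule ℝ (Lp ℝ p μ) :=
    { carrier := {u | (u : Ω → ℝ) ∈ lpClosure p μ V}
      zero_mem' := mem_lpClosure_of_ae_eq (Submodule.zero_mem _) (Lp.coeFn_zero ℝ p μ).symm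
      add_mem' := fun {u v} hu hv =>
        mem_lpClosure_of_ae_eq (Submodule.add_mem _ hu hv) (Lp.coeFn_add u v).symm
      smul_mem' := fun c u hu =>
        mem_lpClosure_of_ae_eq (Submodule.smul_mem _ c hu) (Lp.coeFn_smul c u).symm }
  have hS : IsClosed (S : Set (Lp ℝ p μ)) := by
    refine isClosed_of_closure_subset fun u hu => ?_
    refine mem_lpClosure_of_forall_exists (Lp.memLp u) fun ε hε => ?_
    obtain ⟨v, hv, huv⟩ := EMetric.mem_closure_iff.1 hu ε (pos_iff_ne_zero.2 hε)
    exact ⟨v, hv, by rw [← Lp.edist_def]; exact huv.le⟩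
  let G : ℝ → Lp ℝ p μ := fun y => (hFV y).1.toLp (F y)
  have hGS : ∀ y, G y ∈ S := fun y =>
    mem_lpClosure_of_ae_eq (hFV y) (MemLp.coeFn_toLp (hFV y).1).symm
  let _ : MeasurableSpace (Lp ℝ p μ) := borel _
  have : BorelSpace (Lp ℝ p μ) := ⟨rfl⟩
  -- `Lp` is second countable because the σ-algebra is countably generated and `p` is finite; the
  -- distance to a fixed `u` is measurable in `y` by Tonelli.
  have hGm : Measurable G := by
    refine measurable_of_forall_dist fun u => ?_
    have h1 : (fun y => dist (G y) u) = fun y =>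
        ((∫⁻ x, ‖F y x - (Lp.aestronglyMeasurable u).mk u x‖ₑ ^ p.toReal ∂μ)
          ^ (1 / p.toReal)).toReal := by
      ext y
      rw [Lp.dist_def, ← eLpNorm_eq_lintegral_rpow_enorm_toReal hp0 hp_top]
      congr 1
      refine eLpNorm_congr_ae ?_
      filter_upwards [MemLp.coeFn_toLp (hFV y).1, (Lp.aestronglyMeasurable u).ae_eq_mk]
        with x h1 h2
      simp only [Pi.sub_apply]
      rw [← h2, ← h1]
    rw [h1]
    refine ((Measurable.lintegral_prod_right' (f := fun q : ℝ × Ω =>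
      ‖F q.1 q.2 - (Lp.aestronglyMeasurable u).mk u q.2‖ₑ ^ p.toReal) ?_).pow_const _).ennreal_toReal
    exact ((hF.sub ((Lp.aestronglyMeasurable u).stronglyMeasurable_mk.measurable.comp
      measurable_snd)).enorm).pow_const _
  have hB0 : ∀ y, ‖G y‖ ≤ (μ Set.univ).toReal ^ p.toReal⁻¹ * max B 0 := fun y => by
    rw [Lp.norm_toLp]
    have := eLpNorm_le_of_ae_bound (p := p) (μ := μ) (f := F y) (C := max B 0)
      (Eventually.of_forall fun x => (hB y x).trans (le_max_left _ _))
    refine (ENNReal.toReal_mono ?_ this).trans_eq ?_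
    · exact ENNReal.mul_ne_top (ENNReal.rpow_ne_top_of_nonneg (by positivity)
        (measure_ne_top _ _)) (by simp)
    · rw [ENNReal.toReal_mul, ENNReal.toReal_rpow, ENNReal.toReal_ofReal (le_max_right _ _)]
  have hkG : Integrable (fun y => k y • G y) := by
    refine Integrable.smul_bdd hk _ ?_ (Eventually.of_forall hB0)
    · exact hGm.aestronglyMeasurable
  have hmem : ∫ y, k y • G y ∈ S :=
    S.integral_mem_of_isClosed hS fun y => S.smul_mem _ (hGS y)
  refine mem_lpClosure_of_ae_eq hmem ?_
  have hint : Integrable (fun q : Ω × ℝ => F q.2 q.1 * k q.2) (μ.prod volume) := by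
    refine Integrable.bdd_mul (c := B) (hk.comp_snd μ) ?_ ?_
    · exact (hF.comp measurable_swap).aestronglyMeasurable
    · exact Eventually.of_forall fun q => hB q.2 q.1
  have hint1 : Integrable ((∫ y, k y • G y : Lp ℝ p μ) : Ω → ℝ) μ := (Lp.memLp _).integrable hp.out
  refine Integrable.ae_eq_of_forall_setIntegral_eq _ _ hint1 hint.integral_prod_left
    fun s hs _ => ?_
  -- The Bochner integral in `Lp` is identified with the pointwise integral by comparing integrals
  -- over each measurable `s`: integration over `s` is a continuous functional on `Lp`, and Fubini
  -- does the rest.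
  let I : Lp ℝ p μ →ₗ[ℝ] ℝ :=
    { toFun := fun u => ∫ x in s, u x ∂μ
      map_add' := fun u v => by
        rw [← integral_add ((Lp.memLp u).integrable hp.out).integrableOn
          ((Lp.memLp v).integrable hp.out).integrableOn]
        exact integral_congr_ae (ae_restrict_of_ae (Lp.coeFn_add u v))
      map_smul' := fun c u => by
        rw [RingHom.id_apply, ← integral_smul]
        exact integral_congr_ae (ae_restrict_of_ae (Lp.coeFn_smul c u)) }
  have hI : ∀ u : Lp ℝ p μ,
      ‖I u‖ ≤ (μ Set.univ ^ (1 / (1 : ℝ≥0∞).toReal - 1 / p.toReal)).toReal * ‖u‖ := fun u => by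
    rw [← toReal_enorm, Lp.norm_def, ← ENNReal.toReal_mul]
    refine ENNReal.toReal_mono (ENNReal.mul_ne_top (ENNReal.rpow_ne_top_of_nonneg ?_
      (measure_ne_top _ _)) (Lp.eLpNorm_ne_top u)) ?_
    · rw [sub_nonneg]
      exact one_div_le_one_div_of_le (by simp) (ENNReal.toReal_mono hp_top hp.out)
    · calc ‖I u‖ₑ ≤ ∫⁻ x in s, ‖u x‖ₑ ∂μ := enorm_integral_le_lintegral_enorm _
        _ ≤ ∫⁻ x, ‖u x‖ₑ ∂μ := setLIntegral_le_lintegral _ _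
        _ = eLpNorm u 1 μ := eLpNorm_one_eq_lintegral_enorm.symm
        _ ≤ _ := by
          rw [mul_comm]
          exact eLpNorm_le_eLpNorm_mul_rpow_measure_univ hp.out (Lp.aestronglyMeasurable u)
  let I' : Lp ℝ p μ →L[ℝ] ℝ := I.mkContinuous _ hI
  have := I'.integral_comp_comm hkG
  change ∫ y, I (k y • G y) = ∫ x in s, (∫ y, k y • G y : Lp ℝ p μ) x ∂μ at this
  rw [← this, integral_integral_swap]
  · refine integral_congr_ae (Eventually.of_forall fun y => ?_)
    simp only [map_smul, smul_eq_mul]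
    rw [integral_mul_const, mul_comm]
    congr 1
    exact integral_congr_ae (ae_restrict_of_ae (MemLp.coeFn_toLp (hFV y).1))
  · exact hint.mono_measure (Measure.prod_mono Measure.restrict_le_self le_rfl)

end LpClosure

/-! ### The algebra of bounded multipliers -/

section Multiplier

variable {Ω : Type*} [MeasurableSpace Ω]

/-- The bounded measurable functions that multiply `V` into its `L^p(μ)`-closure. -/
def lpMultiplier (p : ℝ≥0∞) [hp : Fact (1 ≤ p)] (μ : Measure Ω) (V : Submodule ℝ (Ω → ℝ))
    (hV : ∀ g ∈ V, MemLp g p μ) : Subalgebra ℝ (Ω → ℝ) where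
  carrier := {f | Measurable f ∧ (∃ B, ∀ x, |f x| ≤ B) ∧ ∀ g ∈ V, f * g ∈ lpClosure p μ V}
  algebraMap_mem' c := ⟨measurable_const, ⟨|c|, fun _ => le_rfl⟩, fun g hg => by
    rw [← Algebra.smul_def]
    exact Submodule.smul_mem _ c (mem_lpClosure_of_mem hg (hV g hg))⟩
  add_mem' := by
    rintro f f' ⟨hf, ⟨B, hB⟩, h⟩ ⟨hf', ⟨B', hB'⟩, h'⟩
    refine ⟨hf.add hf', ⟨B + B', fun x => (abs_add_le _ _).trans (add_le_add (hB x) (hB' x))⟩,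
      fun g hg => ?_⟩
    rw [add_mul]
    exact Submodule.add_mem _ (h g hg) (h' g hg)
  mul_mem' := by
    rintro f f' ⟨hf, ⟨B, hB⟩, h⟩ ⟨hf', ⟨B', hB'⟩, h'⟩
    refine ⟨hf.mul hf', ⟨B * B', fun x => ?_⟩, fun g hg => ?_⟩
    · rw [Pi.mul_apply, abs_mul]
      exact mul_le_mul (hB x) (hB' x) (abs_nonneg _) ((abs_nonneg _).trans (hB x))
    have hbdd : ∀ u, MemLp u p μ → eLpNorm (f * u) p μ ≤ ENNReal.ofReal |B| * eLpNorm u p μ :=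
      fun u hu => eLpNorm_le_mul_eLpNorm_of_ae_le_mul (Eventually.of_forall fun x => by
        rw [Pi.mul_apply, norm_mul]
        exact mul_le_mul_of_nonneg_right ((hB x).trans (le_abs_self B)) (norm_nonneg _)) p
    have hmem : ∀ u, MemLp u p μ → MemLp (f * u) p μ := fun u hu =>
      ⟨hf.aestronglyMeasurable.mul hu.1, (hbdd u hu).trans_lt
        (ENNReal.mul_lt_top ENNReal.ofReal_lt_top hu.2)⟩
    rw [mul_assoc]
    -- `f' * g` lies only in the closure, not in `V`; it is replaced by a nearby `u ∈ V`, which is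
    -- harmless because multiplication by the bounded `f` is continuous on `L^p`.
    refine mem_lpClosure_of_forall_exists (hmem _ (h' g hg).1) fun ε hε => ?_
    obtain ⟨u, hu, hum, hu'⟩ := (h' g hg).2 (ε / (ENNReal.ofReal |B| + 1)) (by simp [hε])
    refine ⟨f * u, h u hu, ?_⟩
    rw [← mul_sub]
    calc _ ≤ ENNReal.ofReal |B| * eLpNorm (f' * g - u) p μ := hbdd _ ((h' g hg).1.sub hum)
      _ ≤ (ENNReal.ofReal |B| + 1) * (ε / (ENNReal.ofReal |B| + 1)) := by gcongr; simp
      _ = ε := ENNReal.mul_div_cancel (by simp) (by simp)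

variable {p : ℝ≥0∞} [hp : Fact (1 ≤ p)] {μ : Measure Ω} {V : Submodule ℝ (Ω → ℝ)}
  {hV : ∀ g ∈ V, MemLp g p μ}

theorem mem_lpClosure_of_mem_lpMultiplier (h1 : (1 : Ω → ℝ) ∈ V) {f : Ω → ℝ}
    (hf : f ∈ lpMultiplier p μ V hV) : f ∈ lpClosure p μ V := by
  simpa using hf.2.2 1 h1

/-- The multiplier algebra is closed under bounded pointwise limits. -/
theorem mem_lpMultiplier_of_tendsto (hp_top : p ≠ ∞) {f : Ω → ℝ} {g : ℕ → Ω → ℝ}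
    (hg : ∀ m, g m ∈ lpMultiplier p μ V hV) {B : ℝ} (hB : ∀ m x, |g m x| ≤ B)
    (h : ∀ x, Tendsto (fun m => g m x) atTop (𝓝 (f x))) : f ∈ lpMultiplier p μ V hV := by
  refine ⟨measurable_of_tendsto_metrizable (fun m => (hg m).1) (tendsto_pi_nhds.2 h),
    ⟨B, fun x => le_of_tendsto (h x).abs (Eventually.of_forall fun m => hB m x)⟩, fun u hu => ?_⟩
  refine mem_lpClosure_of_dominated hp_top (G := fun x => B * |u x|) (g := fun m => g m * u)
    (fun m => (hg m).2.2 u hu) ((hV u hu).abs.const_mul B) (fun m x => ?_)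
    (fun x => (h x).mul_const (u x))
  rw [Pi.mul_apply, abs_mul]
  exact mul_le_mul_of_nonneg_right (hB m x) (abs_nonneg _)

/-- Weierstrass approximation of `φ` on `[-B, B]`: polynomials in `f` stay in the algebra and
converge boundedly. -/
theorem comp_mem_lpMultiplier (hp_top : p ≠ ∞) {f : Ω → ℝ} (hf : f ∈ lpMultiplier p μ V hV)
    {B : ℝ} (hB : ∀ x, |f x| ≤ B) {φ : ℝ → ℝ} (hφ : Continuous φ) :
    (fun x => φ (f x)) ∈ lpMultiplier p μ V hV := by
  have hP : ∀ m : ℕ, ∃ P : Polynomial ℝ, ∀ y ∈ Set.Icc (-B) B, |P.eval y - φ y| < 1 / (m + 1) :=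
    fun m => exists_polynomial_near_of_continuousOn _ _ φ hφ.continuousOn _ (by positivity)
  choose P hP using hP
  have hmem : ∀ x, f x ∈ Set.Icc (-B) B := fun x => abs_le.1 (hB x)
  obtain ⟨C, hC⟩ := (isCompact_Icc (a := -B) (b := B)).exists_bound_of_continuousOn hφ.continuousOn
  refine mem_lpMultiplier_of_tendsto hp_top (g := fun m x => (P m).eval (f x)) (B := C + 1)
    (fun m => ?_) (fun m x => ?_) (fun x => ?_)
  · have h1 : (fun x => (P m).eval (f x)) = Polynomial.aeval f (P m) := by
      ext x
      rw [← Polynomial.coe_aeval_eq_eval]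
      exact (Polynomial.aeval_algHom_apply (Pi.evalAlgHom ℝ (fun _ : Ω => ℝ) x) f (P m))
    rw [h1]
    exact Algebra.adjoin_le (Set.singleton_subset_iff.2 hf)
      (Polynomial.aeval_mem_adjoin_singleton ℝ f)
  · have h1 := (hP m _ (hmem x)).le
    have h2 := hC _ (hmem x)
    have h3 : (1 : ℝ) / (m + 1) ≤ 1 := by
      rw [div_le_one (by positivity)]; linarith [(Nat.cast_nonneg m : (0:ℝ) ≤ m)]
    rw [Real.norm_eq_abs] at h2
    calc |(P m).eval (f x)| = |φ (f x) + ((P m).eval (f x) - φ (f x))| := by ring_nf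
      _ ≤ C + 1 := (abs_add_le _ _).trans (by linarith)
  · rw [tendsto_iff_norm_sub_tendsto_zero]
    exact squeeze_zero (fun _ => norm_nonneg _) (fun m => (hP m _ (hmem x)).le)
      tendsto_one_div_add_atTop_nhds_zero_nat

/-- The truncations `min 1 (max 0 (m * f))` are continuous functions of `f` that converge boundedly
to the indicator. -/
theorem indicator_pos_mem_lpMultiplier (hp_top : p ≠ ∞) {f : Ω → ℝ}
    (hf : f ∈ lpMultiplier p μ V hV) :
    {x | 0 < f x}.indicator (1 : Ω → ℝ) ∈ lpMultiplier p μ V hV := by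
  obtain ⟨B, hB⟩ := hf.2.1
  refine mem_lpMultiplier_of_tendsto hp_top (g := fun m x => min 1 (max 0 ((m : ℝ) * f x)))
    (B := 1) (fun m => comp_mem_lpMultiplier hp_top hf hB (φ := fun y => min 1 (max 0 (m * y)))
      (by fun_prop)) (fun m x => ?_) (fun x => ?_)
  · rw [abs_of_nonneg (by positivity)]
    exact min_le_left _ _
  · by_cases hx : 0 < f x
    · rw [Set.indicator_of_mem (by exact hx)]
      refine tendsto_const_nhds.congr' ?_
      filter_upwards [(tendsto_natCast_atTop_atTop.atTop_mul_const hx).eventually_ge_atTop 1]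
        with m hm
      rw [max_eq_right (by linarith), min_eq_left hm, Pi.one_apply]
    · rw [Set.indicator_of_notMem (by exact hx)]
      refine tendsto_const_nhds.congr fun m => ?_
      rw [max_eq_left (mul_nonpos_of_nonneg_of_nonpos (by positivity) (not_lt.1 hx))]
      simp

/-- The sets whose indicator is a multiplier form a `σ`-algebra. -/
theorem indicator_mem_lpMultiplier_of_generateFrom (hp_top : p ≠ ∞) {𝒮 : Set (Set Ω)}
    (h𝒮 : ∀ s ∈ 𝒮, s.indicator (1 : Ω → ℝ) ∈ lpMultiplier p μ V hV) {s : Set Ω}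
    (hs : MeasurableSet[MeasurableSpace.generateFrom 𝒮] s) :
    s.indicator (1 : Ω → ℝ) ∈ lpMultiplier p μ V hV := by
  classical
  induction s, hs using MeasurableSpace.generateFrom_induction with
  | hC t ht _ => exact h𝒮 t ht
  | empty =>
    rw [Set.indicator_empty']
    exact Subalgebra.zero_mem _
  | compl t _ ht =>
    rw [Set.indicator_compl]
    exact Subalgebra.sub_mem _ (Subalgebra.one_mem _) ht
  | iUnion t _ ht =>
    -- Since multipliers can be multiplied, finite unions are available by taking complements;
    -- neither `𝒮` being a π-system nor disjointness of the `t i` is needed.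
    have hfin : ∀ m, ((⋃ i ∈ Finset.range m, t i)ᶜ).indicator (1 : Ω → ℝ)
        ∈ lpMultiplier p μ V hV := fun m => by
      have : ((⋃ i ∈ Finset.range m, t i)ᶜ).indicator (1 : Ω → ℝ) =
          ∏ i ∈ Finset.range m, (1 - (t i).indicator (1 : Ω → ℝ)) := by
        ext x
        simp only [Finset.prod_apply, Pi.sub_apply, Pi.one_apply]
        by_cases hx : ∃ i ∈ Finset.range m, x ∈ t i
        · obtain ⟨i, hi, hxi⟩ := hx
          rw [Finset.prod_eq_zero hi (by simp [hxi]), Set.indicator_of_notMem]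
          simp only [Set.mem_compl_iff, Set.mem_iUnion, not_not]
          exact ⟨i, hi, hxi⟩
        · push Not at hx
          rw [Finset.prod_eq_one fun i hi => by simp [hx i hi], Set.indicator_of_mem]
          · rfl
          · simpa using hx
      rw [this]
      exact Subalgebra.prod_mem _ fun i _ => Subalgebra.sub_mem _ (Subalgebra.one_mem _) (ht i)
    refine mem_lpMultiplier_of_tendsto hp_top (B := 1)
      (g := fun m => 1 - ((⋃ i ∈ Finset.range m, t i)ᶜ).indicator (1 : Ω → ℝ))
      (fun m => Subalgebra.sub_mem _ (Subalgebra.one_mem _) (hfin m)) (fun m x => ?_)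
      (fun x => ?_)
    · rw [Set.indicator_compl, sub_sub_cancel]
      by_cases hx : x ∈ ⋃ i ∈ Finset.range m, t i
      · rw [Set.indicator_of_mem hx]; simp
      · rw [Set.indicator_of_notMem hx]; simp
    · simp only [Set.indicator_compl, sub_sub_cancel]
      refine tendsto_const_nhds.congr' ?_
      by_cases hx : ∃ i, x ∈ t i
      · obtain ⟨i, hi⟩ := hx
        filter_upwards [eventually_gt_atTop i] with m hm
        rw [Set.indicator_of_mem (Set.mem_iUnion.2 ⟨i, hi⟩), Set.indicator_of_mem]
        exact Set.mem_biUnion (Finset.mem_coe.2 (Finset.mem_range.2 hm)) hi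
      · push Not at hx
        refine Eventually.of_forall fun m => ?_
        simp [hx]

end Multiplier

/-! ### Density of trigonometric polynomials -/

section TrigonometricDensity

variable {Ω : Type*}

/-- The span of the functions `cos (ℓ + φ)` with `ℓ ∈ Λ` and `φ ∈ ℝ`. -/
def trigSpan (Λ : Submodule ℝ (Ω → ℝ)) : Submodule ℝ (Ω → ℝ) :=
  Submodule.span ℝ {f | ∃ ℓ ∈ Λ, ∃ φ : ℝ, f = fun x => Real.cos (ℓ x + φ)}

theorem one_mem_trigSpan {Λ : Submodule ℝ (Ω → ℝ)} : (1 : Ω → ℝ) ∈ trigSpan Λ :=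
  Submodule.subset_span ⟨0, Λ.zero_mem, 0, by ext; simp⟩

/-- The product-to-sum formula; it makes every wave a multiplier of the span. -/
theorem cos_mul_mem_trigSpan {Λ : Submodule ℝ (Ω → ℝ)} {ℓ : Ω → ℝ} (hℓ : ℓ ∈ Λ) (φ : ℝ) {f : Ω → ℝ} (hf : f ∈ trigSpan Λ) :
    (fun x => Real.cos (ℓ x + φ)) * f ∈ trigSpan Λ := by
  induction hf using Submodule.span_induction with
  | mem f hf =>
    obtain ⟨ℓ', hℓ', φ', rfl⟩ := hf
    have : (fun x => Real.cos (ℓ x + φ)) * (fun x => Real.cos (ℓ' x + φ')) =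
        (1 / 2 : ℝ) • ((fun x => Real.cos ((ℓ + ℓ') x + (φ + φ'))) +
          fun x => Real.cos ((ℓ - ℓ') x + (φ - φ'))) := by
      ext x
      simp only [Pi.mul_apply, Pi.add_apply, Pi.sub_apply, Pi.smul_apply, smul_eq_mul]
      rw [show ℓ x + ℓ' x + (φ + φ') = (ℓ x + φ) + (ℓ' x + φ') by ring,
        show ℓ x - ℓ' x + (φ - φ') = (ℓ x + φ) - (ℓ' x + φ') by ring,
        Real.cos_add (ℓ x + φ), Real.cos_sub (ℓ x + φ)]
      ring
    rw [this]
    exact Submodule.smul_mem _ _ (Submodule.add_mem _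
      (Submodule.subset_span ⟨_, Λ.add_mem hℓ hℓ', _, rfl⟩)
      (Submodule.subset_span ⟨_, Λ.sub_mem hℓ hℓ', _, rfl⟩))
  | zero => rw [mul_zero]; exact Submodule.zero_mem _
  | add f g _ _ hf hg => rw [mul_add]; exact Submodule.add_mem _ hf hg
  | smul c f _ hf => rw [mul_smul_comm]; exact Submodule.smul_mem _ c hf

variable [MeasurableSpace Ω] {p : ℝ≥0∞} {μ : Measure Ω} [IsFiniteMeasure μ] {Λ : Submodule ℝ (Ω → ℝ)}

theorem memLp_of_mem_trigSpan (hΛ : ∀ ℓ ∈ Λ, Measurable ℓ) {f : Ω → ℝ} (hf : f ∈ trigSpan Λ) :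
    MemLp f p μ := by
  induction hf using Submodule.span_induction with
  | mem f hf =>
    obtain ⟨ℓ, hℓ, φ, rfl⟩ := hf
    exact MemLp.of_bound (Real.measurable_cos.comp
      ((hΛ ℓ hℓ).add_const φ)).aestronglyMeasurable 1
      (Eventually.of_forall fun x => Real.abs_cos_le_one _)
  | zero => exact MemLp.zero
  | add f g _ _ hf hg => exact hf.add hg
  | smul c f _ hf => exact hf.const_smul c

/-- Trigonometric polynomials in a family of linear functionals that generates the `σ`-algebra
are dense in `L^p(μ)`. -/
theorem mem_lpClosure_trigSpan [Fact (1 ≤ p)] (hp_top : p ≠ ∞) (hΛ : ∀ ℓ ∈ Λ, Measurable ℓ)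
    (hgen : ‹MeasurableSpace Ω› =
      MeasurableSpace.generateFrom {s | ∃ ℓ ∈ Λ, ∃ c : ℝ, s = {x | c < ℓ x}})
    {H : Ω → ℝ} (hH : MemLp H p μ) : H ∈ lpClosure p μ (trigSpan Λ) := by
  have hV : ∀ g ∈ trigSpan Λ, MemLp g p μ := fun g hg => memLp_of_mem_trigSpan hΛ hg
  have hcos : ∀ ℓ ∈ Λ, ∀ φ : ℝ, (fun x => Real.cos (ℓ x + φ)) ∈ lpMultiplier p μ _ hV :=
    fun ℓ hℓ φ => ⟨Real.measurable_cos.comp ((hΛ ℓ hℓ).add_const φ),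
      ⟨1, fun x => Real.abs_cos_le_one _⟩, fun g hg =>
      mem_lpClosure_of_mem (cos_mul_mem_trigSpan hℓ φ hg) (hV _ (cos_mul_mem_trigSpan hℓ φ hg))⟩
  have hhalf : ∀ ℓ ∈ Λ, ∀ c : ℝ, {x | c < ℓ x}.indicator (1 : Ω → ℝ) ∈ lpMultiplier p μ _ hV := by
    intro ℓ hℓ c
    -- `sin ((ℓ - c) / (m + 1))` has the sign of `ℓ - c` once `|ℓ - c| / (m + 1) < π`, so the
    -- indicators of its positivity sets converge pointwise to that of `{c < ℓ}`.
    have hsin : ∀ m : ℕ, (fun x => Real.sin ((ℓ x - c) / (m + 1))) ∈ lpMultiplier p μ _ hV := by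
      intro m
      convert hcos _ (Λ.smul_mem (1 / ((m : ℝ) + 1)) hℓ) (-(c / (m + 1)) - Real.pi / 2) using 2
        with x
      rw [← Real.cos_sub_pi_div_two, Pi.smul_apply, smul_eq_mul]
      ring_nf
    refine mem_lpMultiplier_of_tendsto hp_top (B := 1)
      (fun m => indicator_pos_mem_lpMultiplier hp_top (hsin m)) (fun m x => ?_) (fun x => ?_)
    · by_cases hx : 0 < Real.sin ((ℓ x - c) / (m + 1))
      · rw [Set.indicator_of_mem (by exact hx)]; simp
      · rw [Set.indicator_of_notMem (by exact hx)]; simp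
    · have hlim : Tendsto (fun m : ℕ => |ℓ x - c| / ((m : ℝ) + 1)) atTop (𝓝 0) := by
        simpa only [mul_one_div, mul_zero] using
          (tendsto_one_div_add_atTop_nhds_zero_nat (𝕜 := ℝ)).const_mul |ℓ x - c|
      refine tendsto_const_nhds.congr' ?_
      filter_upwards [hlim.eventually (gt_mem_nhds Real.pi_pos)] with m hm
      have hm1 : (0 : ℝ) < m + 1 := by positivity
      have habs : |(ℓ x - c) / (m + 1)| < Real.pi := by rwa [abs_div, abs_of_pos hm1]
      by_cases hx : c < ℓ x
      · rw [Set.indicator_of_mem (by exact hx), Set.indicator_of_mem]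
        exact Real.sin_pos_of_pos_of_lt_pi (div_pos (sub_pos.2 hx) hm1) (abs_lt.1 habs).2
      · rw [Set.indicator_of_notMem (by exact hx), Set.indicator_of_notMem]
        simp only [Set.mem_ofPred_eq, not_lt]
        exact Real.sin_nonpos_of_nonpos_of_neg_pi_le
          (div_nonpos_of_nonpos_of_nonneg (sub_nonpos.2 (not_lt.1 hx)) hm1.le) (abs_lt.1 habs).1.le
  have hind : ∀ s, MeasurableSet s → s.indicator (1 : Ω → ℝ) ∈ lpMultiplier p μ _ hV := by
    intro s hs
    refine indicator_mem_lpMultiplier_of_generateFrom hp_top ?_ (hgen ▸ hs)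
    rintro _ ⟨ℓ, hℓ, c, rfl⟩
    exact hhalf ℓ hℓ c
  have hind' : ∀ (c : ℝ) (s : Set Ω), MeasurableSet s →
      s.indicator (fun _ => c) ∈ lpClosure p μ (trigSpan Λ) := fun c s hs => by
    have h1 := Submodule.smul_mem _ c
      (mem_lpClosure_of_mem_lpMultiplier one_mem_trigSpan (hind s hs))
    convert h1 using 1
    ext x
    by_cases hx : x ∈ s <;> simp [hx]
  refine mem_lpClosure_of_forall_exists hH fun ε hε => ?_
  obtain ⟨g, hg, hgP⟩ := MemLp.induction_dense hp_top (· ∈ lpClosure p μ (trigSpan Λ))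
    (fun c s hs _ ε _ => ⟨_, by simp, hind' c s hs⟩)
    (fun f g hf hg => Submodule.add_mem _ hf hg) (fun f hf => hf.1.1) hH hε
  exact ⟨g, hgP, hg⟩

end TrigonometricDensity

/-! ### Mollification of the activation function -/

section Mollify

open scoped ContDiff Convolution

/-- The convolution of `σ` and `φ`. -/
noncomputable def mollify (σ φ : ℝ → ℝ) (x : ℝ) : ℝ := ∫ y, σ (x - y) * φ y

theorem mollify_eq_convolution (σ φ : ℝ → ℝ) :
    mollify σ φ = σ ⋆[ContinuousLinearMap.lsmul ℝ ℝ, volume] φ := by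
  ext x
  rw [mollify, convolution_def, ← integral_sub_left_eq_self _ volume x]
  simp

variable {σ φ : ℝ → ℝ} {B : ℝ}

theorem abs_mollify_le (hB : ∀ s, |σ s| ≤ B) (hφ : Integrable φ) (x : ℝ) :
    |mollify σ φ x| ≤ B * ∫ y, |φ y| := by
  rw [mollify, ← integral_const_mul, ← Real.norm_eq_abs]
  refine norm_integral_le_of_norm_le (hφ.abs.const_mul B) (Eventually.of_forall fun y => ?_)
  rw [norm_mul]
  exact mul_le_mul_of_nonneg_right (hB _) (abs_nonneg _)

theorem locallyIntegrable_of_bounded (hσ : Measurable σ) (hB : ∀ s, |σ s| ≤ B) :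
    LocallyIntegrable σ := by
  refine (locallyIntegrable_const B).mono hσ.aestronglyMeasurable (Eventually.of_forall fun x => ?_)
  exact (hB x).trans (le_abs_self B)

theorem hasDerivAt_mollify (hσ : Measurable σ) (hB : ∀ s, |σ s| ≤ B) (hφ : ContDiff ℝ 1 φ)
    (hc : HasCompactSupport φ) (x : ℝ) :
    HasDerivAt (mollify σ φ) (mollify σ (deriv φ) x) x := by
  simp only [mollify_eq_convolution]
  exact hc.hasDerivAt_convolution_right _ (locallyIntegrable_of_bounded hσ hB) hφ x

/-- A bounded function all of whose mollifications are constant is almost everywhere constant. -/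
theorem exists_mollify_ne_const (hσ : Measurable σ) (hB : ∀ s, |σ s| ≤ B)
    (hc : ¬ ∃ a : ℝ, ∀ᵐ s ∂(volume : Measure ℝ), σ s = a) :
    ∃ φ : ℝ → ℝ, ContDiff ℝ ∞ φ ∧ HasCompactSupport φ ∧ ¬ ∃ a, ∀ x, mollify σ φ x = a := by
  by_contra! hcon
  -- Shrinking bumps whose outer radius is twice the inner one; the bounded ratio is what almost
  -- everywhere convergence of the mollifications requires.
  let f : ℕ → ContDiffBump (0 : ℝ) := fun m =>
    ⟨1 / ((m : ℝ) + 1), 2 * (1 / ((m : ℝ) + 1)), by positivity, by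
      have : (0 : ℝ) < 1 / ((m : ℝ) + 1) := by positivity
      linarith⟩
  have hf : ∀ m, ∃ a, ∀ x, mollify σ ((f m).normed volume) x = a := fun m =>
    hcon _ (f m).contDiff_normed (f m).hasCompactSupport_normed
  choose a ha using hf
  -- The mollifications are constants `a m` that converge to `σ x` for almost every `x`; uniqueness
  -- of limits then makes `σ` almost everywhere constant.
  have hlim : ∀ᵐ x : ℝ, Tendsto a atTop (𝓝 (σ x)) := by
    have h := ContDiffBump.ae_convolution_tendsto_right_of_locallyIntegrable (μ := volume) (φ := f)
      (l := atTop) (K := 2) (g := σ) ?_ (Eventually.of_forall fun m => le_rfl)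
      (locallyIntegrable_of_bounded hσ hB)
    · filter_upwards [h] with x hx
      refine hx.congr fun m => ?_
      rw [← ha m x, mollify, convolution_def]
      simp [mul_comm]
    · simpa only [mul_zero] using (tendsto_one_div_add_atTop_nhds_zero_nat (𝕜 := ℝ)).const_mul 2
  obtain ⟨x₀, hx₀⟩ := hlim.exists
  exact hc ⟨σ x₀, hlim.mono fun x hx => tendsto_nhds_unique hx hx₀⟩

end Mollify

/-! ### Cosine waves as limits of univariate networks -/

section NetworkSpan

open scoped ContDiff

/-- The univariate neural networks with activation function `σ`. -/
def networkSpan (σ : ℝ → ℝ) : Submodule ℝ (ℝ → ℝ) :=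
  Submodule.span ℝ {g | ∃ a b : ℝ, g = fun t => σ (a * t - b)}

/-- `f` is a limit of networks in `L^p(ν)` for every finite measure `ν`. -/
def IsNetworkLimit (p : ℝ≥0∞) [Fact (1 ≤ p)] (σ f : ℝ → ℝ) : Prop :=
  ∀ (ν : Measure ℝ) [IsFiniteMeasure ν], f ∈ lpClosure p ν (networkSpan σ)

variable {p : ℝ≥0∞} [Fact (1 ≤ p)] {σ f g : ℝ → ℝ} {B : ℝ}

theorem comp_affine_mem_networkSpan (hg : g ∈ networkSpan σ) (a b : ℝ) :
    (g ∘ fun t => a * t - b) ∈ networkSpan σ := by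
  induction hg using Submodule.span_induction with
  | mem g hg =>
    obtain ⟨c, d, rfl⟩ := hg
    refine Submodule.subset_span ⟨c * a, c * b + d, ?_⟩
    ext t
    simp only [Function.comp]
    ring_nf
  | zero => exact Submodule.zero_mem _
  | add u v _ _ hu hv => exact Submodule.add_mem _ hu hv
  | smul c u _ hu => exact Submodule.smul_mem _ c hu

theorem isNetworkLimit_self (hσ : Measurable σ) (hB : ∀ s, |σ s| ≤ B) :
    IsNetworkLimit p σ σ := fun _ _ =>
  mem_lpClosure_of_mem (Submodule.subset_span ⟨1, 0, by ext; simp⟩)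
    (MemLp.of_bound hσ.aestronglyMeasurable B (Eventually.of_forall hB))

namespace IsNetworkLimit

/-- An affine substitution replaces `ν` by its image measure, which is why a network limit is
required to work for every finite measure. -/
theorem comp_affine (hf : IsNetworkLimit p σ f) (a b : ℝ) :
    IsNetworkLimit p σ fun t => f (a * t - b) := fun ν _ => by
  have hm : Measurable fun t : ℝ => a * t - b := by fun_prop
  exact lpClosure_comp hm (fun g hg => comp_affine_mem_networkSpan hg a b) (hf (ν.map _))

theorem integral (hp_top : p ≠ ⊤) {F : ℝ → ℝ → ℝ} (hF : Measurable (Function.uncurry F))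
    (hB : ∀ y x, |F y x| ≤ B) (h : ∀ y, IsNetworkLimit p σ (F y)) {k : ℝ → ℝ} (hk : Integrable k) :
    IsNetworkLimit p σ fun x => ∫ y, F y x * k y := fun ν _ =>
  integral_mem_lpClosure hp_top hF hB (fun y => h y ν) hk

theorem mollify (hp_top : p ≠ ⊤) (hσ : Measurable σ) (hB : ∀ s, |σ s| ≤ B) {φ : ℝ → ℝ}
    (hφ : Integrable φ) : IsNetworkLimit p σ (mollify σ φ) :=
  integral hp_top (F := fun y x => σ (x - y)) (hσ.comp (measurable_snd.sub measurable_fst))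
    (fun y x => hB _)
    (fun y => by simpa using (isNetworkLimit_self (p := p) hσ hB).comp_affine 1 y) hφ

end IsNetworkLimit

/-- A bounded function that is not almost everywhere constant generates a smooth network limit
`u''` that does not vanish identically and whose antiderivatives `u'` and `u` are bounded. -/
theorem exists_isNetworkLimit_second_deriv (hp_top : p ≠ ⊤) (hσ : Measurable σ)
    (hB : ∀ s, |σ s| ≤ B) (hc : ¬ ∃ a : ℝ, ∀ᵐ s ∂(volume : Measure ℝ), σ s = a) :
    ∃ (u u' u'' : ℝ → ℝ) (C : ℝ), (∀ x, HasDerivAt u (u' x) x) ∧ (∀ x, HasDerivAt u' (u'' x) x) ∧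
      Continuous u'' ∧ (∀ x, |u x| ≤ C) ∧ (∀ x, |u'' x| ≤ C) ∧ IsNetworkLimit p σ u'' ∧
      ∃ x, u'' x ≠ 0 := by
  obtain ⟨φ, hφ, hφc, hne⟩ := exists_mollify_ne_const hσ hB hc
  have hφ1 : ContDiff ℝ ∞ (deriv φ) := (contDiff_infty_iff_deriv.1 hφ).2
  have hφ2 : ContDiff ℝ ∞ (deriv (deriv φ)) := (contDiff_infty_iff_deriv.1 hφ1).2
  have hi0 : Integrable φ := hφ.continuous.integrable_of_hasCompactSupport hφc
  have hi2 : Integrable (deriv (deriv φ)) :=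
    hφ2.continuous.integrable_of_hasCompactSupport hφc.deriv.deriv
  have hd0 := hasDerivAt_mollify hσ hB (hφ.of_le (by simp)) hφc
  have hd1 := hasDerivAt_mollify hσ hB (hφ1.of_le (by simp)) hφc.deriv
  have hd2 := hasDerivAt_mollify hσ hB (hφ2.of_le (by simp)) hφc.deriv.deriv
  refine ⟨mollify σ φ, mollify σ (deriv φ), mollify σ (deriv (deriv φ)),
    max (B * ∫ y, |φ y|) (B * ∫ y, |deriv (deriv φ) y|), hd0, hd1,
    continuous_iff_continuousAt.2 fun x => (hd2 x).continuousAt,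
    fun x => (abs_mollify_le hB hi0 x).trans (le_max_left _ _),
    fun x => (abs_mollify_le hB hi2 x).trans (le_max_right _ _),
    IsNetworkLimit.mollify hp_top hσ hB hi2, ?_⟩
  -- If `u''` vanished, `u` would be affine, and being bounded it would be constant, against the
  -- choice of `φ`.
  by_contra! h0
  have hconst : ∀ x, mollify σ (deriv φ) x = mollify σ (deriv φ) 0 := fun x =>
    is_const_of_deriv_eq_zero (fun x => (hd1 x).differentiableAt)
      (fun x => by rw [(hd1 x).deriv, h0]) x 0
  set c := mollify σ (deriv φ) 0 with hc_def
  have haff : ∀ x, mollify σ φ x - c * x = mollify σ φ 0 - c * 0 := fun x =>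
    is_const_of_deriv_eq_zero (f := fun x => mollify σ φ x - c * x)
      (fun x => ((hd0 x).sub ((hasDerivAt_id x).const_mul c)).differentiableAt)
      (fun x => by
        have := ((hd0 x).sub ((hasDerivAt_id x).const_mul c)).deriv
        simp only [id, mul_one, hconst x, sub_self] at this
        exact this) x 0
  have hc0 : c = 0 := by
    by_contra hcn
    set D := B * ∫ y, |φ y|
    -- At this point the linear part equals `2 * D + 1`, whereas a function bounded by `D` varies by
    -- at most `2 * D`.
    have h1 := haff ((2 * D + 1) / c)
    have h2 := abs_le.1 (abs_mollify_le hB hi0 ((2 * D + 1) / c))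
    have h3 := abs_le.1 (abs_mollify_le hB hi0 0)
    rw [mul_div_cancel₀ _ hcn] at h1
    linarith [h1, h2.1, h2.2, h3.1, h3.2]
  exact hne ⟨mollify σ φ 0, fun x => by simpa [hc0] using haff x⟩

/-- Averaging a second derivative over dilations produces an integrable network limit. -/
theorem exists_isNetworkLimit_integrable (hp_top : p ≠ ⊤) (hσ : Measurable σ)
    (hB : ∀ s, |σ s| ≤ B) (hc : ¬ ∃ a : ℝ, ∀ᵐ s ∂(volume : Measure ℝ), σ s = a) :
    ∃ (h : ℝ → ℝ) (C : ℝ), Continuous h ∧ Integrable h ∧ (∀ x, |h x| ≤ C) ∧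
      IsNetworkLimit p σ h ∧ h 1 ≠ 0 := by
  obtain ⟨u, u', u'', C, hu, hu', hcont, hC, hC'', hlim, x₀, hx₀⟩ :=
    exists_isNetworkLimit_second_deriv hp_top hσ hB hc
  -- The weight `k` over the dilations is chosen so that the average `h` below satisfies `h 1 = ∫
  -- u'' * k ≠ 0`.
  have hk : ∃ k : ℝ → ℝ, ContDiff ℝ ∞ k ∧ HasCompactSupport k ∧ ∫ x, u'' x * k x ≠ 0 := by
    by_contra! hcon
    have h0 := ae_eq_zero_of_integral_contDiff_smul_eq_zero (μ := volume)
      hcont.locallyIntegrable fun g hg hgc => by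
        simpa [mul_comm] using hcon g hg hgc
    have := (hcont.ae_eq_iff_eq volume continuous_const).1 h0
    exact hx₀ (congrFun this x₀)
  obtain ⟨k, hk, hkc, hk0⟩ := hk
  have hk1 : ContDiff ℝ ∞ (deriv k) := (contDiff_infty_iff_deriv.1 hk).2
  have hk2 : ContDiff ℝ ∞ (deriv (deriv k)) := (contDiff_infty_iff_deriv.1 hk1).2
  have hki : Integrable k := hk.continuous.integrable_of_hasCompactSupport hkc
  have hk2i : Integrable (deriv (deriv k)) :=
    hk2.continuous.integrable_of_hasCompactSupport hkc.deriv.deriv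
  have hucont : Continuous u := continuous_iff_continuousAt.2 fun x => (hu x).continuousAt
  have hu'cont : Continuous u' := continuous_iff_continuousAt.2 fun x => (hu' x).continuousAt
  set h : ℝ → ℝ := fun t => ∫ α, u'' (α * t) * k α with h_def
  have hbound : ∀ t, |h t| ≤ C * ∫ α, |k α| := fun t => by
    rw [h_def, ← integral_const_mul, ← Real.norm_eq_abs]
    refine norm_integral_le_of_norm_le (hki.abs.const_mul C) (Eventually.of_forall fun y => ?_)
    rw [norm_mul]
    exact mul_le_mul_of_nonneg_right (hC'' _) (abs_nonneg _)
  -- Two integrations by parts in the dilation parameter trade `t ^ 2 * u''` for `u`. As `u` is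
  -- bounded, `h` decays like `1 / (1 + t ^ 2)` and is integrable.
  have hparts : ∀ t, t ^ 2 * h t = ∫ α, u (α * t) * deriv (deriv k) α := fun t => by
    have hd : ∀ α, HasDerivAt (fun α => u (α * t)) (u' (α * t) * t) α := fun α => by
      simpa [Function.comp_def] using (hu (α * t)).comp α ((hasDerivAt_id α).mul_const t)
    have hd' : ∀ α, HasDerivAt (fun α => u' (α * t) * t) (u'' (α * t) * t * t) α := fun α => by
      simpa [Function.comp_def] using
        ((hu' (α * t)).comp α ((hasDerivAt_id α).mul_const t)).mul_const t
    have hkd : ∀ α, HasDerivAt k (deriv k α) α := fun α =>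
      (hk.differentiable (by simp) α).hasDerivAt
    have hkd' : ∀ α, HasDerivAt (deriv k) (deriv (deriv k) α) α := fun α =>
      (hk1.differentiable (by simp) α).hasDerivAt
    have hi : ∀ v w : ℝ → ℝ, Continuous v → Continuous w → HasCompactSupport w →
        Integrable (v * w) := fun v w hv hw hwc =>
      (hv.mul hw).integrable_of_hasCompactSupport hwc.mul_left
    have h1 := integral_mul_deriv_eq_deriv_mul_of_integrable (u := fun α => u (α * t))
      (v := deriv k) (fun α _ => hd α) (fun α _ => hkd' α)
      (hi _ _ (by fun_prop) hk2.continuous hkc.deriv.deriv)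
      (hi _ _ (by fun_prop) hk1.continuous hkc.deriv)
      (hi _ _ (by fun_prop) hk1.continuous hkc.deriv)
    have h2 := integral_mul_deriv_eq_deriv_mul_of_integrable (u := fun α => u' (α * t) * t)
      (v := k) (fun α _ => hd' α) (fun α _ => hkd α)
      (hi _ _ (by fun_prop) hk1.continuous hkc.deriv)
      (hi _ _ (by fun_prop) hk.continuous hkc)
      (hi _ _ (by fun_prop) hk.continuous hkc)
    rw [h1, h2, neg_neg, h_def, ← integral_const_mul]
    congr 1
    ext α
    ring
  have hcont_h : Continuous h := by
    refine continuous_of_dominated (F := fun t α => u'' (α * t) * k α)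
      (bound := fun α => C * |k α|) (fun t => ?_) (fun t => Eventually.of_forall fun α => ?_)
      (hki.abs.const_mul C) (Eventually.of_forall fun α => by fun_prop)
    · exact Continuous.aestronglyMeasurable ((by fun_prop : Continuous fun α => u'' (α * t)).mul
        hk.continuous)
    · rw [norm_mul]
      exact mul_le_mul_of_nonneg_right (hC'' _) (abs_nonneg _)
  refine ⟨h, _, hcont_h, ?_, hbound, ?_, by simpa [h_def] using hk0⟩
  · set D := C * (∫ α, |k α|) + C * ∫ α, |deriv (deriv k) α|
    refine (integrable_inv_one_add_sq.const_mul D).mono' hcont_h.aestronglyMeasurable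
      (Eventually.of_forall fun t => ?_)
    have h2 : t ^ 2 * |h t| ≤ C * ∫ α, |deriv (deriv k) α| := by
      rw [show t ^ 2 * |h t| = |t ^ 2 * h t| by rw [abs_mul, abs_sq], hparts,
        ← integral_const_mul, ← Real.norm_eq_abs]
      refine norm_integral_le_of_norm_le (hk2i.abs.const_mul C)
        (Eventually.of_forall fun y => ?_)
      rw [norm_mul]
      exact mul_le_mul_of_nonneg_right (hC _) (abs_nonneg _)
    rw [Real.norm_eq_abs, ← div_eq_mul_inv, le_div_iff₀ (by positivity)]
    linarith [hbound t]
  · exact IsNetworkLimit.integral hp_top (F := fun α t => u'' (α * t))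
      (by
        have : Continuous (Function.uncurry fun α t => u'' (α * t)) := by
          simp only [Function.uncurry_def]; fun_prop
        exact this.measurable) (fun _ _ => hC'' _)
      (fun α => by simpa using hlim.comp_affine α 0) hki

open scoped FourierTransform in
/-- An integrable continuous function that is not identically zero has a nonvanishing Fourier
coefficient at a nonzero frequency. -/
theorem exists_fourier_coeff_ne_zero {h : ℝ → ℝ} (hcont : Continuous h) (hi : Integrable h)
    {x : ℝ} (hx : h x ≠ 0) :
    ∃ κ : ℝ, κ ≠ 0 ∧ (∫ y, h y * Real.cos (κ * y)) ^ 2 + (∫ y, h y * Real.sin (κ * y)) ^ 2 ≠ 0 := by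
  by_contra! hcon
  have hfour : ∀ w : ℝ, w ≠ 0 → 𝓕 (fun y => (h y : ℂ)) w = 0 := by
    intro w hw
    have h0 := hcon (-(2 * Real.pi * w)) (by simp [hw, Real.pi_ne_zero])
    have hC : ∫ y, h y * Real.cos (-(2 * Real.pi * w) * y) = 0 := by nlinarith
    have hS : ∫ y, h y * Real.sin (-(2 * Real.pi * w) * y) = 0 := by nlinarith
    have hic : Integrable fun y => h y * Real.cos (-(2 * Real.pi * w) * y) :=
      hi.mul_bdd (c := 1) (by fun_prop) (Eventually.of_forall fun y => Real.abs_cos_le_one _)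
    have his : Integrable fun y => h y * Real.sin (-(2 * Real.pi * w) * y) :=
      hi.mul_bdd (c := 1) (by fun_prop) (Eventually.of_forall fun y => Real.abs_sin_le_one _)
    rw [Real.fourier_real_eq_integral_exp_smul]
    have : ∀ y : ℝ, Complex.exp (↑(-2 * Real.pi * y * w) * Complex.I) • (h y : ℂ) =
        ((h y * Real.cos (-(2 * Real.pi * w) * y) : ℝ) : ℂ) +
          ((h y * Real.sin (-(2 * Real.pi * w) * y) : ℝ) : ℂ) * Complex.I := fun y => by
      rw [Complex.exp_mul_I, ← Complex.ofReal_cos, ← Complex.ofReal_sin,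
        show -2 * Real.pi * y * w = -(2 * Real.pi * w) * y by ring, smul_eq_mul]
      push_cast
      ring
    simp only [this]
    rw [integral_add hic.ofReal (his.ofReal.mul_const _), integral_mul_const,
      integral_complex_ofReal, integral_complex_ofReal, hC, hS]
    simp
  -- Frequency `0` is a null set, so excluding it does not affect Fourier inversion. It has to be
  -- excluded because the frequency found here is later used as a divisor.
  have hae : 𝓕 (fun y => (h y : ℂ)) =ᵐ[volume] 0 := by
    filter_upwards [compl_mem_ae_iff.2 (measure_singleton (0 : ℝ))] with w hw
    exact hfour w hw
  have hinv := (Complex.continuous_ofReal.comp hcont).fourierInv_fourier_eq hi.ofReal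
    ((integrable_zero ℝ ℂ volume).congr hae.symm)
  have := congrFun hinv x
  rw [Real.fourierInv_eq', integral_eq_zero_of_ae] at this
  · exact hx (by simpa using this.symm)
  · filter_upwards [hae] with w hw
    simp only [Function.comp_def] at hw ⊢
    rw [hw]
    simp

/-- Every cosine wave is a network limit, for any bounded measurable activation function that is
not almost everywhere constant. -/
theorem isNetworkLimit_cos (hp_top : p ≠ ⊤) (hσ : Measurable σ)
    (hB : ∀ s, |σ s| ≤ B) (hc : ¬ ∃ a : ℝ, ∀ᵐ s ∂(volume : Measure ℝ), σ s = a) (a b : ℝ) :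
    IsNetworkLimit p σ fun t => Real.cos (a * t - b) := by
  obtain ⟨h, C, hcont, hi, hC, hlim, h1⟩ := exists_isNetworkLimit_integrable hp_top hσ hB hc
  obtain ⟨κ, hκ, hne⟩ := exists_fourier_coeff_ne_zero hcont hi h1
  set c := ∫ y, h y * Real.cos (κ * y)
  set s := ∫ y, h y * Real.sin (κ * y)
  have hconv : ∀ t, ∫ y, h (t - y) * Real.cos (κ * y) =
      c * Real.cos (κ * t) + s * Real.sin (κ * t) := fun t => by
    rw [← integral_sub_left_eq_self _ volume t, ← integral_mul_const, ← integral_mul_const,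
      ← integral_add]
    · congr 1
      ext y
      rw [sub_sub_cancel, mul_sub, Real.cos_sub]
      ring
    · exact (hi.mul_bdd (c := 1) (by fun_prop)
        (Eventually.of_forall fun y => Real.abs_cos_le_one _)).mul_const _
    · exact (hi.mul_bdd (c := 1) (by fun_prop)
        (Eventually.of_forall fun y => Real.abs_sin_le_one _)).mul_const _
  have hwave : IsNetworkLimit p σ fun t => c * Real.cos (κ * t) + s * Real.sin (κ * t) := by
    intro ν _
    -- The cosine is not integrable, so it is truncated to `[-m, m]`; the truncated convolutions are
    -- bounded by `∫ ‖h‖` and converge pointwise.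
    let k : ℕ → ℝ → ℝ := fun m => (Set.Icc (-(m : ℝ)) m).indicator fun y => Real.cos (κ * y)
    have hkm : ∀ m, Measurable (k m) := fun m =>
      (by fun_prop : Measurable fun y => Real.cos (κ * y)).indicator measurableSet_Icc
    have hk1 : ∀ m y, |k m y| ≤ 1 := fun m y => by
      simp only [k, Set.indicator_apply]
      split_ifs
      · exact Real.abs_cos_le_one _
      · simp
    have hki : ∀ m, Integrable (k m) := fun m =>
      ((by fun_prop : Continuous fun y => Real.cos (κ * y)).integrableOn_Icc).integrable_indicator
        measurableSet_Icc
    have hshift : ∀ t, Integrable fun y => h (t - y) := fun t => hi.comp_sub_left t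
    have hdom : ∀ m t y, ‖h (t - y) * k m y‖ ≤ ‖h (t - y)‖ := fun m t y => by
      rw [norm_mul]
      exact mul_le_of_le_one_right (norm_nonneg _) (hk1 m y)
    refine mem_lpClosure_of_dominated hp_top (g := fun m t => ∫ y, h (t - y) * k m y)
      (G := fun _ => ∫ y, ‖h y‖) (fun m => ?_) (memLp_const _) (fun m t => ?_) fun t => ?_
    · exact integral_mem_lpClosure hp_top (F := fun y t => h (t - y))
        (hcont.measurable.comp (measurable_snd.sub measurable_fst)) (fun _ _ => hC _)
        (fun y => by simpa using hlim.comp_affine 1 y ν) (hki m)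
    · rw [← integral_sub_left_eq_self (fun y => ‖h y‖) volume t]
      exact norm_integral_le_of_norm_le (hshift t).norm (Eventually.of_forall (hdom m t))
    · rw [← hconv t]
      refine tendsto_integral_of_dominated_convergence (fun y => ‖h (t - y)‖)
        (fun m => ((hshift t).1.mul (hkm m).aestronglyMeasurable)) (hshift t).norm
        (fun m => Eventually.of_forall (hdom m t)) (Eventually.of_forall fun y => ?_)
      refine tendsto_const_nhds.congr' ?_
      obtain ⟨m₀, hm₀⟩ := exists_nat_ge |y|
      filter_upwards [eventually_ge_atTop m₀] with m hm
      have : |y| ≤ m := hm₀.trans (by exact_mod_cast hm)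
      simp only [k]
      rw [Set.indicator_of_mem (by exact abs_le.1 this)]
  have hcos : IsNetworkLimit p σ fun t => Real.cos (κ * t) := by
    intro ν _
    have h2 := hwave.comp_affine 1 (Real.pi / 2 / κ) ν
    -- A quarter-period shift turns `c cos + s sin` into `c sin - s cos`; combining the two with
    -- weights `c` and `-s` leaves `(c ^ 2 + s ^ 2) cos`.
    have h3 := Submodule.smul_mem _ (1 / (c ^ 2 + s ^ 2))
      (Submodule.sub_mem _ (Submodule.smul_mem _ c (hwave ν)) (Submodule.smul_mem _ s h2))
    convert h3 using 1
    ext t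
    have h4 : κ * (1 * t - Real.pi / 2 / κ) = κ * t - Real.pi / 2 := by field_simp
    simp only [Pi.smul_apply, Pi.sub_apply, smul_eq_mul, h4, Real.cos_sub_pi_div_two,
      Real.sin_sub_pi_div_two]
    field_simp
    ring
  convert hcos.comp_affine (a / κ) (b / κ) using 3
  field_simp

end NetworkSpan

/-! ### Networks uniformly close to the identity -/

section UniformNetwork

open scoped ContDiff

variable {σ : ℝ → ℝ} {B : ℝ}

theorem not_ae_const_of_continuous (hσ : Continuous σ) (hc : ¬ ∃ a : ℝ, ∀ s, σ s = a) :
    ¬ ∃ a : ℝ, ∀ᵐ s ∂(volume : Measure ℝ), σ s = a := fun ⟨a, ha⟩ =>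
  hc ⟨a, congrFun ((hσ.ae_eq_iff_eq volume continuous_const).1 ha)⟩

/-- A mollified continuous activation function is a locally uniform limit of networks. -/
theorem exists_network_near_mollify (hσ : Continuous σ) {φ : ℝ → ℝ} (hφ : Continuous φ)
    (hφc : HasCompactSupport φ) (R : ℝ) {ε : ℝ} (hε : 0 < ε) :
    ∃ g ∈ networkSpan σ, ∀ t, |t| ≤ R → |g t - mollify σ φ t| ≤ ε := by
  let K := Set.Icc (-R) R
  let S₀ : Submodule ℝ C(K, ℝ) :=
    { carrier := {v | ∃ g ∈ networkSpan σ, ∀ t : K, v t = g t}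
      zero_mem' := ⟨0, Submodule.zero_mem _, fun _ => rfl⟩
      add_mem' := by
        rintro v v' ⟨g, hg, hv⟩ ⟨g', hg', hv'⟩
        exact ⟨g + g', Submodule.add_mem _ hg hg', fun t => by simp [hv, hv']⟩
      smul_mem' := by
        rintro c v ⟨g, hg, hv⟩
        exact ⟨c • g, Submodule.smul_mem _ c hg, fun t => by simp [hv]⟩ }
  -- On the compact `K`, the mollification is a Bochner integral in `C(K, ℝ)` of translates of `σ`,
  -- all of which lie in the network subspace `S₀`; hence it lies in the uniform closure of `S₀`.
  let f : C(ℝ, C(K, ℝ)) := ContinuousMap.curry ⟨fun q => σ (q.2 - q.1), by fun_prop⟩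
  have hint : Integrable fun y => φ y • f y :=
    (hφ.smul f.continuous).integrable_of_hasCompactSupport hφc.smul_right
  have hmem : ∫ y, φ y • f y ∈ S₀.topologicalClosure := by
    refine Submodule.integral_mem_of_isClosed _ S₀.isClosed_topologicalClosure fun y => ?_
    refine Submodule.smul_mem _ _ (S₀.le_topologicalClosure ?_)
    exact ⟨fun t => σ (1 * t - y), Submodule.subset_span ⟨1, y, rfl⟩, fun t => by simp [f]⟩
  obtain ⟨v, ⟨g, hg, hv⟩, hd⟩ := Metric.mem_closure_iff.1 hmem ε hε
  refine ⟨g, hg, fun t ht => ?_⟩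
  let t' : K := ⟨t, abs_le.1 ht⟩
  have h1 : (∫ y, φ y • f y) t' = mollify σ φ t := by
    rw [ContinuousMap.integral_apply hint, mollify]
    simp [f, t', mul_comm]
  have h2 := (ContinuousMap.dist_apply_le_dist t').trans hd.le
  rw [h1, hv t', dist_comm, Real.dist_eq] at h2
  exact h2

/-- At a point `θ` with nonzero derivative, the difference quotient `(s (θ + δ * t) - s θ) / (δ * s'
θ)` of a mollification `s` tends to `t` as `δ → 0`, uniformly for bounded `t`; then `s` is replaced
by a network. -/
theorem exists_network_near_id (hσ : Continuous σ) (hB : ∀ s, |σ s| ≤ B)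
    (hc : ¬ ∃ a : ℝ, ∀ s, σ s = a) (R : ℝ) {ε : ℝ} (hε : 0 < ε) :
    ∃ g ∈ networkSpan σ, ∀ t, |t| ≤ R → |g t - t| ≤ ε := by
  obtain ⟨φ, hφ, hφc, hne⟩ :=
    exists_mollify_ne_const hσ.measurable hB (not_ae_const_of_continuous hσ hc)
  have hd := hasDerivAt_mollify hσ.measurable hB (hφ.of_le (by simp)) hφc
  set s := mollify σ φ
  set s' := mollify σ (deriv φ)
  obtain ⟨θ, hθ⟩ : ∃ θ, s' θ ≠ 0 := by
    by_contra! h0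
    exact hne ⟨s 0, fun x => is_const_of_deriv_eq_zero (fun x => (hd x).differentiableAt)
      (fun x => by rw [(hd x).deriv, h0]) x 0⟩
  set R' := max R 1 with hR'
  have hR'0 : 0 < R' := zero_lt_one.trans_le (le_max_right _ _)
  have hs0 : 0 < |s' θ| := abs_pos.2 hθ
  -- Error budget before division by `δ * s' θ`: the Taylor remainder takes `|s' θ| * δ * ε / 2`, by
  -- `|δ * t| ≤ δ * R'`, and each of the two replacements of `s` by `g` takes a quarter of `|s' θ| *
  -- δ * ε`.
  have hlo := (hasDerivAt_iff_isLittleO_nhds_zero.1 (hd θ)).def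
    (c := |s' θ| * ε / (2 * R')) (by positivity)
  obtain ⟨r, hr, hball⟩ := Metric.eventually_nhds_iff.1 hlo
  set δ := r / (2 * R') with hδ
  have hδ0 : 0 < δ := by positivity
  obtain ⟨g, hg, hgs⟩ := exists_network_near_mollify hσ hφ.continuous hφc (|θ| + δ * R')
    (ε := |s' θ| * δ * ε / 4) (by positivity)
  refine ⟨(δ * s' θ)⁻¹ • ((g ∘ fun t => δ * t - -θ) - (g ∘ fun t => 0 * t - -θ)),
    Submodule.smul_mem _ _ (Submodule.sub_mem _ (comp_affine_mem_networkSpan hg _ _)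
      (comp_affine_mem_networkSpan hg _ _)), fun t ht => ?_⟩
  have htR : |t| ≤ R' := ht.trans (le_max_left _ _)
  have hδt : |δ * t| ≤ δ * R' := by
    rw [abs_mul, abs_of_pos hδ0]; exact mul_le_mul_of_nonneg_left htR hδ0.le
  have h1 := hgs (δ * t - -θ) (by
    rw [sub_neg_eq_add, add_comm]
    exact (abs_add_le _ _).trans (by linarith))
  have h2 := hgs (0 * t - -θ) (by
    rw [zero_mul, zero_sub, neg_neg]
    have : 0 < δ * R' := by positivity
    linarith)
  have h3 := @hball (δ * t) (by
    rw [dist_zero_right, Real.norm_eq_abs]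
    refine hδt.trans_lt ?_
    rw [hδ]
    field_simp
    linarith)
  rw [Real.norm_eq_abs, Real.norm_eq_abs] at h3
  have h4 : |s' θ| * ε / (2 * R') * |δ * t| ≤ |s' θ| * δ * ε / 2 := by
    refine (mul_le_mul_of_nonneg_left hδt (by positivity)).trans_eq ?_
    field_simp
  have h5 : θ + δ * t = δ * t - -θ := by ring
  have h6 : θ = 0 * t - -θ := by ring
  rw [smul_eq_mul, h5] at h3
  have h7 : s θ = s (0 * t - -θ) := by rw [← h6]
  rw [h7] at h3
  have hkey : |g (δ * t - -θ) - g (0 * t - -θ) - δ * t * s' θ| ≤ |s' θ| * δ * ε := by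
    have e : g (δ * t - -θ) - g (0 * t - -θ) - δ * t * s' θ =
      (g (δ * t - -θ) - s (δ * t - -θ)) + (s (δ * t - -θ) - s (0 * t - -θ) - δ * t * s' θ) -
        (g (0 * t - -θ) - s (0 * t - -θ)) := by ring
    rw [e]
    refine (abs_sub _ _).trans ?_
    have := abs_add_le (g (δ * t - -θ) - s (δ * t - -θ))
      (s (δ * t - -θ) - s (0 * t - -θ) - δ * t * s' θ)
    linarith
  have e2 : ((δ * s' θ)⁻¹ • ((g ∘ fun t => δ * t - -θ) - (g ∘ fun t => 0 * t - -θ))) t - t =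
      (δ * s' θ)⁻¹ * (g (δ * t - -θ) - g (0 * t - -θ) - δ * t * s' θ) := by
    simp only [Pi.smul_apply, Pi.sub_apply, Function.comp_apply, smul_eq_mul]
    field_simp
  rw [e2, abs_mul, abs_inv, abs_mul, abs_of_pos hδ0, inv_mul_le_iff₀ (by positivity)]
  linarith

/-- Networks that approximate the identity so well that their iterates do, too. -/
theorem exists_network_iterate_tendsto_id (hσ : Continuous σ) (hB : ∀ s, |σ s| ≤ B)
    (hc : ¬ ∃ a : ℝ, ∀ s, σ s = a) :
    ∃ g : ℕ → ℝ → ℝ, (∀ m, g m ∈ networkSpan σ) ∧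
      ∀ k t, Tendsto (fun m => (g m)^[k] t) atTop (𝓝 t) := by
  choose g hg hgid using fun m : ℕ => exists_network_near_id hσ hB hc (m : ℝ)
    (ε := 1 / ((m : ℝ) + 1)) (by positivity)
  refine ⟨g, hg, fun k t => ?_⟩
  induction k with
  | zero => simp
  | succ k ih =>
    simp only [Function.iterate_succ_apply']
    -- `g m` is close to the identity only on `[-m, m]`; the `k`-th iterate eventually stays below
    -- `|t| + 1` and thus inside this window.
    have hev : ∀ᶠ m : ℕ in atTop, |(g m)^[k] t| ≤ m := by
      obtain ⟨m₀, hm₀⟩ := exists_nat_ge (|t| + 1)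
      filter_upwards [ih.abs.eventually (gt_mem_nhds (lt_add_one |t|)), eventually_ge_atTop m₀]
        with m hm hmm
      exact hm.le.trans (hm₀.trans (by exact_mod_cast hmm))
    have hdiff : Tendsto (fun m => g m ((g m)^[k] t) - (g m)^[k] t) atTop (𝓝 0) := by
      refine squeeze_zero_norm' ?_ (tendsto_one_div_add_atTop_nhds_zero_nat (𝕜 := ℝ))
      filter_upwards [hev] with m hm
      exact hgid m _ hm
    simpa using hdiff.add ih

end UniformNetwork

/-! ### Ranked reservoirs and the echo state property -/

namespace ReservoirSystem

variable {n N : ℕ}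

/-- `ρ` ranks the state components such that each component of the new state depends only on
components of smaller rank of the previous state. -/
def IsRanked (S : ReservoirSystem n N) (ρ : Fin N → ℕ) : Prop :=
  ∀ x x' z i, (∀ j, ρ j < ρ i → x j = x' j) → S.F x z i = S.F x' z i

/-- The state reached at time `t` after `m` steps started from the zero state. -/
def run (S : ReservoirSystem n N) (z : Signal n) : ℕ → ℤ → Fin N → ℝ
  | 0, _ => 0
  | m + 1, t => S.F (S.run z m (t - 1)) (z t)

variable {S : ReservoirSystem n N} {ρ : Fin N → ℕ} {z : Signal n}

/-- A component of rank `r` forgets the initial state after `r + 1` steps, since each step back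
strictly lowers the ranks involved. -/
theorem IsRanked.run_eq_run (hρ : S.IsRanked ρ) {m m' : ℕ} (t : ℤ) (i : Fin N) (hm : ρ i < m)
    (hm' : ρ i < m') : S.run z m t i = S.run z m' t i := by
  induction m generalizing m' t i with
  | zero => omega
  | succ m ih =>
    obtain ⟨m', rfl⟩ : ∃ l, m' = l + 1 := ⟨m' - 1, by omega⟩
    exact hρ _ _ _ _ fun j hj => ih _ _ (by omega) (by omega)

theorem IsRanked.eq_run (hρ : S.IsRanked ρ) {x : ℤ → Fin N → ℝ} (hx : S.IsSolution z x)
    {m : ℕ} (t : ℤ) (i : Fin N) (hm : ρ i < m) : x t i = S.run z m t i := by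
  induction m generalizing t i with
  | zero => omega
  | succ m ih =>
    rw [hx t]
    exact hρ _ _ _ _ fun j hj => ih _ _ (by omega)

theorem run_congr {w : Signal n} {t : ℤ} (h : ∀ τ ≤ t, z τ = w τ) (m : ℕ) :
    S.run z m t = S.run w m t := by
  induction m generalizing t with
  | zero => rfl
  | succ m ih =>
    rw [run, run, h t le_rfl, ih fun τ hτ => h τ (by omega)]

/-- Running for one step more than the maximal rank gives a state independent of the start; this is
a solution, and any solution must agree with it. -/
theorem IsRanked.echoStateProperty (hρ : S.IsRanked ρ) : S.EchoStateProperty := by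
  intro z
  have hlt : ∀ i, ρ i < Finset.univ.sup ρ + 1 := fun i =>
    Nat.lt_succ_of_le (Finset.le_sup (Finset.mem_univ i))
  refine ⟨S.run z (Finset.univ.sup ρ + 1), fun t => ?_, fun x hx => ?_⟩
  · ext i
    rw [hρ.run_eq_run (m' := Finset.univ.sup ρ + 2) t i (hlt i) ((hlt i).trans (by omega))]
    rfl
  · ext t i
    exact hρ.eq_run hx t i (hlt i)

theorem filter_eq (hS : S.EchoStateProperty) {x : ℤ → Fin N → ℝ} (hx : S.IsSolution z x)
    (t : ℤ) : S.filter hS z t = S.h (x t) := by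
  rw [filter, (hS z).unique (hS z).choose_spec.1 hx]

/-- A shifted solution solves the shifted equation, and solutions are unique. -/
theorem isTimeInvariant_filter (hS : S.EchoStateProperty) : IsTimeInvariant (S.filter hS) := by
  intro τ z
  ext t
  obtain ⟨x, hx, -⟩ := hS z
  have hx' : S.IsSolution (timeDelay τ z) (timeDelay τ x) := fun s => by
    simp only [timeDelay]
    rw [hx (s + τ), show s + τ - 1 = s - 1 + τ by ring]
  rw [timeDelay, filter_eq hS hx, filter_eq hS hx']
  rfl

theorem IsRanked.isCausal_filter (hρ : S.IsRanked ρ) (hS : S.EchoStateProperty) :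
    IsCausal (S.filter hS) := by
  intro z w t hzw
  obtain ⟨x, hx, -⟩ := hS z
  obtain ⟨y, hy, -⟩ := hS w
  rw [filter_eq hS hx, filter_eq hS hy]
  congr 1
  ext i
  rw [hρ.eq_run hx t i (Nat.lt_succ_self _), hρ.eq_run hy t i (Nat.lt_succ_self _),
    run_congr hzw]

/-- A ranked reservoir system approximates `H` if the readout of an explicit state sequence does. -/
theorem IsRanked.approximates (hρ : S.IsRanked ρ) {x : Signal n → ℤ → Fin N → ℝ}
    (hx : ∀ z, S.IsSolution z (x z)) {G H : PastPath n → ℝ}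
    (hG : ∀ z : PastPath n, S.h (x z.extend 0) = G z) {p : ℝ≥0∞} {μ : Measure (PastPath n)}
    {ε : ℝ} (hGm : Measurable G) (hGp : MemLp G p μ)
    (hε : eLpNorm (H - G) p μ < ENNReal.ofReal ε) : S.Approximates H p μ ε := by
  have hS := hρ.echoStateProperty
  have hfun : S.functional hS = G := by
    ext z
    rw [← hG, functional, functionalOf, filter_eq hS (hx z.extend)]
  refine ⟨hS, hρ.isCausal_filter hS, isTimeInvariant_filter hS, ?_⟩
  rw [hfun]
  exact ⟨hGm, hGp, hε⟩

theorem mulVec_apply_congr {ι : Type*} [Fintype ι] {A : Matrix ι ι ℝ} {ρ : ι → ℕ} {i : ι}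
    (hA : ∀ j, A i j ≠ 0 → ρ j < ρ i) {x x' : ι → ℝ} (h : ∀ j, ρ j < ρ i → x j = x' j) :
    (A *ᵥ x) i = (A *ᵥ x') i := by
  simp only [Matrix.mulVec, dotProduct]
  refine Finset.sum_congr rfl fun j _ => ?_
  by_cases hj : A i j = 0
  · simp [hj]
  · rw [h j (hA j hj)]

end ReservoirSystem

theorem PastPath.extend_neg {n : ℕ} (z : PastPath n) (k : ℕ) :
    z.extend (0 - (k : ℤ)) = z (NonposInt.ofNeg k) := by
  have : 0 - (k : ℤ) ≤ 0 := by omega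
  rw [PastPath.extend, dif_pos this]
  congr 1
  exact Subtype.ext (by simp [NonposInt.ofNeg])

/-! ### Shift registers -/

section LinearReservoir

variable {n : ℕ}

open ReservoirSystem

/-- The connectivity matrix of a shift register. -/
def shiftMatrix (K n : ℕ) : Matrix (Fin K × Fin n) (Fin K × Fin n) ℝ :=
  fun a b => if (b.1 : ℕ) + 1 = a.1 ∧ a.2 = b.2 then 1 else 0

/-- The input matrix of a shift register. -/
def shiftInput (K n : ℕ) : Matrix (Fin K × Fin n) (Fin n) ℝ :=
  fun a j => if (a.1 : ℕ) = 0 ∧ a.2 = j then 1 else 0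

/-- Slot `(k, i)` stores coordinate `i` of the input `k` steps ago: slot `0` reads the input and
slot `k + 1` copies slot `k` of the previous state. -/
theorem shift_isSolution (K : ℕ) (z : Signal n) (t : ℤ) (a : Fin K × Fin n) :
    z (t - (a.1 : ℕ)) a.2 = (shiftMatrix K n *ᵥ fun b => z (t - 1 - (b.1 : ℕ)) b.2) a +
      (shiftInput K n *ᵥ z t) a := by
  obtain ⟨⟨k, hk⟩, i⟩ := a
  simp only [Matrix.mulVec, dotProduct, shiftMatrix, shiftInput, ite_mul, one_mul, zero_mul]
  rcases k with _ | k
  · simp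
  · rw [Finset.sum_eq_single (⟨k, by omega⟩, i)]
    · simp only [Nat.cast_add, Nat.cast_one, and_self, if_true, Nat.add_eq_zero_iff, one_ne_zero,
        and_false, false_and, if_false, Finset.sum_const_zero, add_zero]
      rw [show t - ((k : ℤ) + 1) = t - 1 - k by ring]
    · rintro ⟨⟨l, hl⟩, j⟩ _ hne
      rw [if_neg]
      rintro ⟨h1, h2⟩
      simp only at h1 h2
      subst h2
      exact hne (by simp; omega)
    · simp

/-- Readouts of the last `K` inputs are functionals of linear reservoirs. -/
theorem linear_approximates {K N : ℕ} (e : Fin N ≃ Fin K × Fin n) {h : (Fin N → ℝ) → ℝ}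
    {H : PastPath n → ℝ} {p : ℝ≥0∞} {μ : Measure (PastPath n)} {ε : ℝ}
    (hm : Measurable fun z : PastPath n => h fun a => z (NonposInt.ofNeg (e a).1) (e a).2)
    (hp : MemLp (fun z : PastPath n => h fun a => z (NonposInt.ofNeg (e a).1) (e a).2) p μ)
    (hε : eLpNorm (H - fun z : PastPath n => h fun a => z (NonposInt.ofNeg (e a).1) (e a).2) p μ
      < ENNReal.ofReal ε) :
    (linear ((shiftMatrix K n).submatrix e e) ((shiftInput K n).submatrix e id) h).Approximates
      H p μ ε := by
  refine IsRanked.approximates (ρ := fun a => (e a).1) (fun x x' z a hxx' => ?_)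
    (x := fun z t a => z (t - ((e a).1 : ℕ)) (e a).2) (fun z t => ?_) (fun z => ?_) hm hp hε
  · simp only [linear, Pi.add_apply]
    congr 1
    refine mulVec_apply_congr (ρ := fun a => ((e a).1 : ℕ)) (fun b hb => ?_) hxx'
    simp only [Matrix.submatrix_apply, shiftMatrix] at hb
    have := (ite_ne_right_iff.1 hb).1.1
    omega
  · ext a
    simp only [linear, Pi.add_apply]
    rw [shift_isSolution K z t (e a)]
    congr 1
    simp only [Matrix.mulVec, dotProduct, Matrix.submatrix_apply]
    exact (e.sum_comp fun b => shiftMatrix K n (e a) b * z (t - 1 - (b.1 : ℕ)) b.2).symm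
  · simp only [linear, PastPath.extend_neg]

end LinearReservoir

/-! ### Trigonometric polynomials on path space -/

section PastPathTrigonometric

variable {n : ℕ}

/-- The linear functionals on path space that depend on finitely many coordinates. -/
def pathFunctionals (n : ℕ) : Submodule ℝ (PastPath n → ℝ) :=
  Submodule.span ℝ (Set.range fun (q : ℕ × Fin n) (z : PastPath n) => z (NonposInt.ofNeg q.1) q.2)

theorem measurable_coordinate (t : NonposInt) (i : Fin n) :
    Measurable fun z : PastPath n => z t i :=
  (measurable_pi_apply i).comp (measurable_pi_apply t)

theorem measurable_of_mem_pathFunctionals {ℓ : PastPath n → ℝ} (hℓ : ℓ ∈ pathFunctionals n) :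
    Measurable ℓ := by
  induction hℓ using Submodule.span_induction with
  | mem f hf =>
    obtain ⟨q, rfl⟩ := hf
    exact measurable_coordinate _ _
  | zero => exact measurable_const
  | add f g _ _ hf hg => exact hf.add hg
  | smul c f _ hf => exact hf.const_smul c

/-- The representation holds for all large `K`, so that finitely many functionals can share one
window. -/
theorem exists_eq_sum_of_mem_pathFunctionals {ℓ : PastPath n → ℝ} (hℓ : ℓ ∈ pathFunctionals n) :
    ∃ u : ℕ → Fin n → ℝ, ∀ᶠ K in atTop, ∀ z : PastPath n,
      ℓ z = ∑ k ∈ Finset.range K, ∑ i, u k i * z (NonposInt.ofNeg k) i := by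
  induction hℓ using Submodule.span_induction with
  | mem f hf =>
    obtain ⟨⟨k, i⟩, rfl⟩ := hf
    refine ⟨Pi.single k (Pi.single i 1), ?_⟩
    filter_upwards [eventually_gt_atTop k] with K hK z
    rw [Finset.sum_eq_single k, Finset.sum_eq_single i]
    · simp
    · intro j _ hj
      simp [hj]
    · simp
    · intro l _ hl
      simp [hl]
    · simp [hK]
  | zero => exact ⟨0, Eventually.of_forall fun K z => by simp⟩
  | add f g _ _ hf hg =>
    obtain ⟨u, hu⟩ := hf
    obtain ⟨v, hv⟩ := hg
    refine ⟨u + v, ?_⟩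
    filter_upwards [hu, hv] with K h1 h2 z
    simp [h1, h2, add_mul, Finset.sum_add_distrib]
  | smul c f _ hf =>
    obtain ⟨u, hu⟩ := hf
    refine ⟨c • u, ?_⟩
    filter_upwards [hu] with K h1 z
    simp [h1, Finset.mul_sum, mul_assoc]

theorem pastPath_measurableSpace_eq (n : ℕ) :
    (inferInstance : MeasurableSpace (PastPath n)) = MeasurableSpace.generateFrom
      {s | ∃ ℓ ∈ pathFunctionals n, ∃ c : ℝ, s = {x | c < ℓ x}} := by
  refine le_antisymm ?_ (MeasurableSpace.generateFrom_le ?_)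
  · change (⨆ t, MeasurableSpace.comap (fun z : PastPath n => z t)
      (⨆ i, MeasurableSpace.comap (fun v : Fin n → ℝ => v i) inferInstance)) ≤ _
    refine iSup_le fun t => ?_
    rw [MeasurableSpace.comap_iSup]
    refine iSup_le fun i => ?_
    rw [MeasurableSpace.comap_comp, ← measurable_iff_comap_le]
    refine measurable_of_Ioi fun c => ?_
    refine MeasurableSpace.measurableSet_generateFrom ⟨_, Submodule.subset_span
      ⟨((-t.1).toNat, i), rfl⟩, c, ?_⟩
    have ht : NonposInt.ofNeg (-t.1).toNat = t := Subtype.ext (by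
      have := t.2
      simp only [NonposInt.ofNeg]; omega)
    ext z
    simp [ht]
  · rintro _ ⟨ℓ, hℓ, c, rfl⟩
    exact measurableSet_lt measurable_const (measurable_of_mem_pathFunctionals hℓ)

/-- The linear functional with coefficients `u` on the last `K` inputs. -/
def pathFunctional (K : ℕ) (u : ℕ → Fin n → ℝ) (z : PastPath n) : ℝ :=
  ∑ k ∈ Finset.range K, ∑ i, u k i * z (NonposInt.ofNeg k) i

theorem measurable_pathFunctional (K : ℕ) (u : ℕ → Fin n → ℝ) :
    Measurable (pathFunctional K u) := by
  unfold pathFunctional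
  refine Finset.measurable_sum _ fun k _ => Finset.measurable_sum _ fun i _ => ?_
  exact (measurable_coordinate _ _).const_mul _

/-- Trigonometric polynomials of the last `K` inputs are dense in `L^p`. -/
theorem exists_trigonometric_near {p : ℝ≥0∞} [Fact (1 ≤ p)] (hp_top : p ≠ ⊤)
    {μ : Measure (PastPath n)} [IsFiniteMeasure μ] {H : PastPath n → ℝ} (hH : MemLp H p μ)
    {ε : ℝ≥0∞} (hε : ε ≠ 0) :
    ∃ (J K : ℕ) (a φ : Fin J → ℝ) (u : Fin J → ℕ → Fin n → ℝ),
      eLpNorm (H - fun z => ∑ j, a j * Real.cos (pathFunctional (K + 1) (u j) z + φ j)) p μ ≤ ε := by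
  have hmem := mem_lpClosure_trigSpan (p := p) (μ := μ) hp_top
    (fun ℓ hℓ => measurable_of_mem_pathFunctionals hℓ) (pastPath_measurableSpace_eq n) hH
  obtain ⟨g, hg, -, hHg⟩ := hmem.2 ε hε
  have hform : ∃ (J : ℕ) (a φ : Fin J → ℝ) (u : Fin J → ℕ → Fin n → ℝ), ∀ᶠ K in atTop,
      ∀ z, g z = ∑ j, a j * Real.cos (pathFunctional K (u j) z + φ j) := by
    clear hHg
    induction hg using Submodule.span_induction with
    | mem f hf =>
      obtain ⟨ℓ, hℓ, φ, rfl⟩ := hf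
      obtain ⟨u, hu⟩ := exists_eq_sum_of_mem_pathFunctionals hℓ
      refine ⟨1, fun _ => 1, fun _ => φ, fun _ => u, ?_⟩
      filter_upwards [hu] with K hK z
      simp [hK, pathFunctional]
    | zero => exact ⟨0, 0, 0, 0, Eventually.of_forall fun K z => by simp⟩
    | add f g _ _ hf hg =>
      obtain ⟨J, a, φ, u, hu⟩ := hf
      obtain ⟨J', a', φ', u', hu'⟩ := hg
      refine ⟨J + J', Fin.append a a', Fin.append φ φ', Fin.append u u', ?_⟩
      filter_upwards [hu, hu'] with K h1 h2 z
      simp [Fin.sum_univ_add, h1, h2]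
    | smul c f _ hf =>
      obtain ⟨J, a, φ, u, hu⟩ := hf
      refine ⟨J, c • a, φ, u, ?_⟩
      filter_upwards [hu] with K h1 z
      simp [h1, Finset.mul_sum, mul_assoc]
  obtain ⟨J, a, φ, u, hu⟩ := hform
  obtain ⟨K, hK⟩ := ((tendsto_add_atTop_nat 1).eventually hu).exists
  refine ⟨J, K, a, φ, u, ?_⟩
  rwa [show g = _ from funext hK] at hHg

end PastPathTrigonometric

/-! ### Polynomials under exponential moments -/

section PolynomialDensity

variable {Ω ι : Type*}

/-- The polynomials in the components of `X`. -/
noncomputable def polynomialAlgebra (X : Ω → ι → ℝ) : Subalgebra ℝ (Ω → ℝ) :=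
  (MvPolynomial.aeval fun i ω => X ω i : MvPolynomial ι ℝ →ₐ[ℝ] Ω → ℝ).range

theorem aeval_comp_apply (X : Ω → ι → ℝ) (q : MvPolynomial ι ℝ) (ω : Ω) :
    (MvPolynomial.aeval fun i ω => X ω i : MvPolynomial ι ℝ →ₐ[ℝ] Ω → ℝ) q ω =
      MvPolynomial.eval (X ω) q := by
  induction q using MvPolynomial.induction_on with
  | C a => simp
  | add q r hq hr => simp [hq, hr]
  | mul_X q i hq => simp [hq]

/-- Every rate `δ` works because the induction spends half of it on the new factor, through `|x i| ≤
2 / δ * exp (δ / 2 * ∑ |x i|)`. -/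
theorem exists_abs_eval_le_exp [Fintype ι] (q : MvPolynomial ι ℝ) {δ : ℝ} (hδ : 0 < δ) :
    ∃ C : ℝ, 0 ≤ C ∧ ∀ x : ι → ℝ, |MvPolynomial.eval x q| ≤ C * Real.exp (δ * ∑ i, |x i|) := by
  induction q using MvPolynomial.induction_on generalizing δ with
  | C a =>
    refine ⟨|a|, abs_nonneg _, fun x => ?_⟩
    rw [MvPolynomial.eval_C]
    refine le_mul_of_one_le_right (abs_nonneg _) (Real.one_le_exp ?_)
    exact mul_nonneg hδ.le (Finset.sum_nonneg fun i _ => abs_nonneg _)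
  | add q r hq hr =>
    obtain ⟨C, hC, h⟩ := hq hδ
    obtain ⟨C', hC', h'⟩ := hr hδ
    refine ⟨C + C', add_nonneg hC hC', fun x => ?_⟩
    rw [map_add, add_mul]
    exact (abs_add_le _ _).trans (add_le_add (h x) (h' x))
  | mul_X q i hq =>
    obtain ⟨C, hC, h⟩ := hq (half_pos hδ)
    refine ⟨C * (2 / δ), by positivity, fun x => ?_⟩
    have hx : |x i| ≤ ∑ i, |x i| :=
      Finset.single_le_sum (f := fun i => |x i|) (fun i _ => abs_nonneg _) (Finset.mem_univ i)
    have h1 : |x i| ≤ 2 / δ * Real.exp (δ / 2 * ∑ i, |x i|) := by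
      have h2 := Real.add_one_le_exp (δ / 2 * ∑ i, |x i|)
      rw [div_mul_eq_mul_div, le_div_iff₀ hδ]
      nlinarith
    rw [map_mul, MvPolynomial.eval_X, abs_mul]
    calc _ ≤ (C * Real.exp (δ / 2 * ∑ i, |x i|)) * (2 / δ * Real.exp (δ / 2 * ∑ i, |x i|)) :=
          mul_le_mul (h x) h1 (abs_nonneg _) (mul_nonneg hC (Real.exp_nonneg _))
      _ = C * (2 / δ) * (Real.exp (δ / 2 * ∑ i, |x i|) * Real.exp (δ / 2 * ∑ i, |x i|)) := by ring
      _ = _ := by rw [← Real.exp_add]; ring_nf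

variable [Fintype ι] [MeasurableSpace Ω] {p : ℝ≥0∞} {μ : Measure Ω} {X : Ω → ι → ℝ}

theorem memLp_of_mem_polynomialAlgebra (hX : ∀ i, Measurable fun ω => X ω i) {β : ℝ} (hβ : 0 < β)
    (hexp : MemLp (fun ω => Real.exp (β * ∑ i, |X ω i|)) p μ) {f : Ω → ℝ}
    (hf : f ∈ polynomialAlgebra X) : MemLp f p μ := by
  obtain ⟨q, rfl⟩ := hf
  obtain ⟨C, -, hC⟩ := exists_abs_eval_le_exp q hβ
  refine (hexp.const_mul C).mono' (Measurable.aestronglyMeasurable ?_)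
    (Eventually.of_forall fun ω => ?_)
  · simp only [AlgHom.toRingHom_eq_coe, RingHom.coe_coe]
    rw [show (MvPolynomial.aeval fun i ω => X ω i : MvPolynomial ι ℝ →ₐ[ℝ] Ω → ℝ) q = fun ω =>
      MvPolynomial.eval (X ω) q from funext fun ω => aeval_comp_apply X q ω]
    exact (MvPolynomial.continuous_eval q).measurable.comp (measurable_pi_iff.2 hX)
  · simp only [AlgHom.toRingHom_eq_coe, RingHom.coe_coe]
    rw [aeval_comp_apply]
    exact hC _

variable [hp : Fact (1 ≤ p)]

theorem memLp_exp_of_integrable (hp_top : p ≠ ⊤) (hX : ∀ i, Measurable fun ω => X ω i) {α : ℝ}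
    (hα : Integrable (fun ω => Real.exp (α * ∑ i, |X ω i|)) μ) :
    MemLp (fun ω => Real.exp (α / p.toReal * ∑ i, |X ω i|)) p μ := by
  have hp0 : p ≠ 0 := (zero_lt_one.trans_le hp.out).ne'
  have hp0' : 0 < p.toReal := ENNReal.toReal_pos hp0 hp_top
  rw [← integrable_norm_rpow_iff (by fun_prop) hp0 hp_top]
  convert hα using 2 with ω
  rw [Real.norm_eq_abs, Real.abs_exp, ← Real.exp_mul]
  congr 1
  field_simp

/-- Entire functions dominated by the exponential act as multipliers of the polynomials after
a rescaling of the argument. -/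
theorem powerSeries_mem_lpMultiplier (hp_top : p ≠ ⊤)
    {β : ℝ} (hβ : 0 < β) (hexp : MemLp (fun ω => Real.exp (β * ∑ i, |X ω i|)) p μ)
    (hV : ∀ g ∈ Subalgebra.toSubmodule (polynomialAlgebra X), MemLp g p μ)
    {F : ℝ → ℝ} (hF : Continuous F) (hF1 : ∀ y, |F y| ≤ 1) {c : ℕ → ℝ} {d : ℕ → ℕ}
    (hlim : ∀ y, Tendsto (fun m => ∑ j ∈ Finset.range m, c j * y ^ d j) atTop (𝓝 (F y)))
    (hdom : ∀ m y, |∑ j ∈ Finset.range m, c j * y ^ d j| ≤ Real.exp |y|)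
    {ℓ : Ω → ℝ} (hℓ : ℓ ∈ polynomialAlgebra X) (hℓm : Measurable ℓ)
    (hℓβ : ∀ ω, |ℓ ω| ≤ β / 2 * ∑ i, |X ω i|) :
    (fun ω => F (ℓ ω)) ∈ lpMultiplier p μ _ hV := by
  refine ⟨hF.measurable.comp hℓm, ⟨1, fun ω => hF1 _⟩, fun g hg => ?_⟩
  obtain ⟨q, rfl⟩ := hg
  set g : Ω → ℝ := MvPolynomial.aeval (fun i ω => X ω i) q
  have hg : g ∈ polynomialAlgebra X := ⟨q, rfl⟩
  obtain ⟨C, hC0, hC⟩ := exists_abs_eval_le_exp q (half_pos hβ)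
  have hmem : ∀ m, (∑ j ∈ Finset.range m, c j • ℓ ^ d j) * g ∈
      Subalgebra.toSubmodule (polynomialAlgebra X) := fun m =>
    Subalgebra.mul_mem _ (Subalgebra.sum_mem _ fun j _ =>
      Subalgebra.smul_mem _ (Subalgebra.pow_mem _ hℓ _) _) hg
  -- The partial sums and the polynomial `g` each use half of the rate `β`, so their product is
  -- dominated by `C * exp (β * ∑ |X i|)`, which is in `L^p`.
  refine mem_lpClosure_of_dominated hp_top
    (g := fun m => (∑ j ∈ Finset.range m, c j • ℓ ^ d j) * g)
    (fun m => mem_lpClosure_of_mem (hmem m) (hV _ (hmem m))) (hexp.const_mul C)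
    (fun m ω => ?_) (fun ω => ?_)
  · have h1 := hdom m (ℓ ω)
    have h2 : |g ω| ≤ C * Real.exp (β / 2 * ∑ i, |X ω i|) := by
      rw [show g ω = MvPolynomial.eval (X ω) q from aeval_comp_apply X q ω]
      exact hC _
    have h3 : Real.exp |ℓ ω| ≤ Real.exp (β / 2 * ∑ i, |X ω i|) := Real.exp_le_exp.2 (hℓβ ω)
    simp only [Pi.mul_apply, Finset.sum_apply, Pi.smul_apply, Pi.pow_apply, smul_eq_mul, abs_mul]
    calc _ ≤ Real.exp (β / 2 * ∑ i, |X ω i|) * (C * Real.exp (β / 2 * ∑ i, |X ω i|)) :=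
          mul_le_mul (h1.trans h3) h2 (abs_nonneg _) (Real.exp_nonneg _)
      _ = C * (Real.exp (β / 2 * ∑ i, |X ω i|) * Real.exp (β / 2 * ∑ i, |X ω i|)) := by ring
      _ = _ := by rw [← Real.exp_add]; ring_nf
  · simpa using (hlim (ℓ ω)).mul_const (g ω)

/-- Termwise domination by the series of `cosh |y|`, uniformly in the number of terms. -/
theorem abs_sum_cos_series_le (m : ℕ) (y : ℝ) :
    |∑ j ∈ Finset.range m, (-1) ^ j / ((2 * j).factorial : ℝ) * y ^ (2 * j)| ≤ Real.exp |y| := by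
  calc _ ≤ ∑ j ∈ Finset.range m, |y| ^ (2 * j) / ((2 * j).factorial : ℝ) := by
        refine (Finset.abs_sum_le_sum_abs _ _).trans_eq (Finset.sum_congr rfl fun j _ => ?_)
        rw [abs_mul, abs_div, abs_pow, abs_neg, abs_one, one_pow, abs_pow, Nat.abs_cast]
        ring
    _ ≤ Real.cosh |y| :=
        sum_le_hasSum _ (fun j _ => by positivity) (Real.hasSum_cosh |y|)
    _ ≤ Real.exp |y| := by
        rw [← Real.cosh_add_sinh]
        linarith [Real.sinh_nonneg_iff.2 (abs_nonneg y)]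

theorem abs_sum_sin_series_le (m : ℕ) (y : ℝ) :
    |∑ j ∈ Finset.range m, (-1) ^ j / ((2 * j + 1).factorial : ℝ) * y ^ (2 * j + 1)| ≤
      Real.exp |y| := by
  calc _ ≤ ∑ j ∈ Finset.range m, |y| ^ (2 * j + 1) / ((2 * j + 1).factorial : ℝ) := by
        refine (Finset.abs_sum_le_sum_abs _ _).trans_eq (Finset.sum_congr rfl fun j _ => ?_)
        rw [abs_mul, abs_div, abs_pow, abs_neg, abs_one, one_pow, abs_pow, Nat.abs_cast]
        ring
    _ ≤ Real.sinh |y| :=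
        sum_le_hasSum _ (fun j _ => by positivity) (Real.hasSum_sinh |y|)
    _ ≤ Real.exp |y| := by
        rw [← Real.cosh_add_sinh]
        linarith [Real.cosh_pos |y|]

/-- Under exponential moments, cosine waves are `L^p`-limits of polynomials. -/
theorem cos_mem_lpClosure_polynomialAlgebra (hp_top : p ≠ ⊤)
    (hX : ∀ i, Measurable fun ω => X ω i) {α : ℝ} (hα0 : 0 < α)
    (hα : Integrable (fun ω => Real.exp (α * ∑ i, |X ω i|)) μ) (u : ι → ℝ) (φ : ℝ) :
    (fun ω => Real.cos (∑ i, u i * X ω i + φ)) ∈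
      lpClosure p μ (Subalgebra.toSubmodule (polynomialAlgebra X)) := by
  have hp0' : 0 < p.toReal := ENNReal.toReal_pos (zero_lt_one.trans_le hp.out).ne' hp_top
  set β := α / p.toReal with hβ_def
  have hβ : 0 < β := div_pos hα0 hp0'
  have hexp : MemLp (fun ω => Real.exp (β * ∑ i, |X ω i|)) p μ :=
    memLp_exp_of_integrable hp_top hX hα
  have hV : ∀ g ∈ Subalgebra.toSubmodule (polynomialAlgebra X), MemLp g p μ :=
    fun g hg => memLp_of_mem_polynomialAlgebra hX hβ hexp hg
  -- Dividing the functional by a large integer `M` brings it below the rate `β / 2` that the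
  -- moments allow; being an integer, `M` can be undone by `M` angle additions.
  obtain ⟨M, hM⟩ := exists_nat_gt ((∑ i, |u i|) / (β / 2))
  have hM0 : (0 : ℝ) < M := lt_of_le_of_lt
    (div_nonneg (Finset.sum_nonneg fun i _ => abs_nonneg _) (by positivity)) hM
  set ℓ : Ω → ℝ := fun ω => (∑ i, u i * X ω i) / M with hℓ_def
  have hℓ : ℓ ∈ polynomialAlgebra X := by
    have : ℓ = ∑ i, (u i / M) • fun ω => X ω i := by
      ext ω
      simp only [hℓ_def, Finset.sum_apply, Pi.smul_apply, smul_eq_mul, Finset.sum_div]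
      exact Finset.sum_congr rfl fun i _ => by ring
    have hXi : ∀ i, (fun ω => X ω i) ∈ polynomialAlgebra X := fun i => ⟨MvPolynomial.X i, by simp⟩
    rw [this]
    exact Subalgebra.sum_mem _ fun i _ => Subalgebra.smul_mem _ (hXi i) _
  have hℓm : Measurable ℓ :=
    (Finset.measurable_sum _ fun i _ => (hX i).const_mul _).div_const _
  have hℓβ : ∀ ω, |ℓ ω| ≤ β / 2 * ∑ i, |X ω i| := fun ω => by
    have h1 : |∑ i, u i * X ω i| ≤ (∑ i, |u i|) * ∑ i, |X ω i| := by
      refine (Finset.abs_sum_le_sum_abs _ _).trans ?_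
      rw [Finset.sum_mul]
      refine Finset.sum_le_sum fun i _ => ?_
      rw [abs_mul]
      exact mul_le_mul_of_nonneg_left (Finset.single_le_sum (f := fun i => |X ω i|)
        (fun i _ => abs_nonneg _) (Finset.mem_univ i)) (abs_nonneg _)
    have h2 : ∑ i, |u i| ≤ β / 2 * M := by
      rw [div_lt_iff₀ (by positivity)] at hM
      linarith
    rw [hℓ_def, abs_div, abs_of_pos hM0, div_le_iff₀ hM0]
    calc _ ≤ _ := h1
      _ ≤ (β / 2 * M) * ∑ i, |X ω i| :=
        mul_le_mul_of_nonneg_right h2 (Finset.sum_nonneg fun i _ => abs_nonneg _)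
      _ = _ := by ring
  have hcos : (fun ω => Real.cos (ℓ ω)) ∈ lpMultiplier p μ _ hV :=
    powerSeries_mem_lpMultiplier hp_top hβ hexp hV Real.continuous_cos Real.abs_cos_le_one
      (c := fun j => (-1) ^ j / ((2 * j).factorial : ℝ)) (d := fun j => 2 * j)
      (fun y => by
        refine (Real.hasSum_cos y).tendsto_sum_nat.congr fun m => ?_
        exact Finset.sum_congr rfl fun j _ => by ring)
      abs_sum_cos_series_le hℓ hℓm hℓβ
  have hsin : (fun ω => Real.sin (ℓ ω)) ∈ lpMultiplier p μ _ hV :=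
    powerSeries_mem_lpMultiplier hp_top hβ hexp hV Real.continuous_sin Real.abs_sin_le_one
      (c := fun j => (-1) ^ j / ((2 * j + 1).factorial : ℝ)) (d := fun j => 2 * j + 1)
      (fun y => by
        refine (Real.hasSum_sin y).tendsto_sum_nat.congr fun m => ?_
        exact Finset.sum_congr rfl fun j _ => by ring)
      abs_sum_sin_series_le hℓ hℓm hℓβ
  -- Angle addition only multiplies multipliers, so the frequency grows without any stronger moment
  -- condition.
  have hmul : ∀ k : ℕ, (fun ω => Real.cos (k * ℓ ω)) ∈ lpMultiplier p μ _ hV ∧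
      (fun ω => Real.sin (k * ℓ ω)) ∈ lpMultiplier p μ _ hV := fun k => by
    induction k with
    | zero =>
      simp only [Nat.cast_zero, zero_mul, Real.cos_zero, Real.sin_zero]
      exact ⟨Subalgebra.one_mem _, Subalgebra.zero_mem _⟩
    | succ k ih =>
      simp only [Nat.cast_succ, add_mul, one_mul, Real.cos_add, Real.sin_add]
      exact ⟨Subalgebra.sub_mem _ (Subalgebra.mul_mem _ ih.1 hcos) (Subalgebra.mul_mem _ ih.2 hsin),
        Subalgebra.add_mem _ (Subalgebra.mul_mem _ ih.2 hcos) (Subalgebra.mul_mem _ ih.1 hsin)⟩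
  refine mem_lpClosure_of_mem_lpMultiplier (hV := hV) (Subalgebra.one_mem _) ?_
  convert Subalgebra.sub_mem _ (Subalgebra.smul_mem _ (hmul M).1 (Real.cos φ))
    (Subalgebra.smul_mem _ (hmul M).2 (Real.sin φ)) using 1
  ext ω
  simp only [Pi.sub_apply, Pi.smul_apply, smul_eq_mul, hℓ_def]
  rw [mul_div_cancel₀ _ hM0.ne', Real.cos_add]
  ring

end PolynomialDensity

/-! ### Linear reservoirs with polynomial and network readouts -/

section Families

variable {n : ℕ} {p : ℝ≥0∞} [hp : Fact (1 ≤ p)] {μ : Measure (PastPath n)} [IsFiniteMeasure μ]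

open ReservoirSystem

/-- If cosine waves are limits of elements of `V K`, then so is, for some `K`, any function in
`L^p`. -/
theorem exists_near_of_cos_mem (hp_top : p ≠ ⊤) {V : ℕ → Submodule ℝ (PastPath n → ℝ)}
    (hV : ∀ (K : ℕ) (u : ℕ → Fin n → ℝ) (φ : ℝ),
      (fun z => Real.cos (pathFunctional (K + 1) u z + φ)) ∈ lpClosure p μ (V K))
    {H : PastPath n → ℝ} (hH : MemLp H p μ) {ε : ℝ} (hε : 0 < ε) :
    ∃ K, ∃ g ∈ V K, MemLp g p μ ∧ eLpNorm (H - g) p μ < ENNReal.ofReal ε := by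
  have hε0 : ENNReal.ofReal (ε / 3) ≠ 0 := by simpa using hε
  obtain ⟨J, K, a, φ, u, hT⟩ := exists_trigonometric_near hp_top hH hε0
  set T : PastPath n → ℝ := fun z => ∑ j, a j * Real.cos (pathFunctional (K + 1) (u j) z + φ j)
    with hT_def
  have hTmem : T ∈ lpClosure p μ (V K) := by
    have : T = ∑ j, a j • fun z => Real.cos (pathFunctional (K + 1) (u j) z + φ j) := by
      ext z
      simp [hT_def]
    rw [this]
    exact Submodule.sum_mem _ fun j _ => Submodule.smul_mem _ _ (hV K _ _)
  obtain ⟨g, hg, hgm, hTg⟩ := hTmem.2 _ hε0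
  refine ⟨K, g, hg, hgm, ?_⟩
  rw [show H - g = (H - T) + (T - g) by abel]
  calc _ ≤ _ := eLpNorm_add_le (hH.sub hTmem.1).1 (hTmem.1.sub hgm).1 hp.out
    _ ≤ _ := add_le_add hT hTg
    _ = ENNReal.ofReal (ε / 3 + ε / 3) := (ENNReal.ofReal_add (by positivity) (by positivity)).symm
    _ < _ := (ENNReal.ofReal_lt_ofReal_iff hε).2 (by linarith)

/-- The last `K` inputs of a path. -/
def pathWindow (K : ℕ) (z : PastPath n) (q : Fin K × Fin n) : ℝ := z (NonposInt.ofNeg q.1) q.2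

theorem pathFunctional_eq_sum_window (K : ℕ) (u : ℕ → Fin n → ℝ) (z : PastPath n) :
    pathFunctional K u z = ∑ q : Fin K × Fin n, u q.1 q.2 * pathWindow K z q := by
  rw [pathFunctional, Finset.sum_range, Fintype.sum_prod_type]
  rfl

theorem exists_linear_polynomial_approximates (hp_top : p ≠ ⊤) (hμ : HasExponentialMoments μ)
    {H : PastPath n → ℝ} (hH : MemLp H p μ) {ε : ℝ} (hε : 0 < ε) :
    ∃ (N : ℕ) (A : Matrix (Fin N) (Fin N) ℝ) (c : Matrix (Fin N) (Fin n) ℝ)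
      (h : MvPolynomial (Fin N) ℝ),
      (linear A c (fun x => MvPolynomial.eval x h)).Approximates H p μ ε := by
  have hX : ∀ K, ∀ q, Measurable fun z : PastPath n => pathWindow K z q :=
    fun K q => measurable_coordinate _ _
  obtain ⟨K, g, ⟨q, rfl⟩, hgm, hg⟩ := exists_near_of_cos_mem hp_top
    (V := fun K => Subalgebra.toSubmodule (polynomialAlgebra (pathWindow (n := n) (K + 1))))
    (fun K u φ => by
      obtain ⟨α, hα0, hα⟩ := hμ K
      simp only [pathFunctional_eq_sum_window]
      refine cos_mem_lpClosure_polynomialAlgebra hp_top (hX _) hα0 ?_ (fun q => u q.1 q.2) φ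
      convert hα using 4 with z
      rw [Finset.sum_range, Fintype.sum_prod_type]
      rfl) hH hε
  let e : Fin ((K + 1) * n) ≃ Fin (K + 1) × Fin n := finProdFinEquiv.symm
  have heval : (fun z : PastPath n => MvPolynomial.eval
      (fun a => z (NonposInt.ofNeg (e a).1) (e a).2) (MvPolynomial.rename e.symm q)) =
      (MvPolynomial.aeval fun i z => pathWindow (K + 1) z i :
        MvPolynomial (Fin (K + 1) × Fin n) ℝ →ₐ[ℝ] PastPath n → ℝ) q := by
    ext z
    rw [aeval_comp_apply, MvPolynomial.eval_rename]
    congr 2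
    ext i
    simp [pathWindow]
  refine ⟨_, _, _, MvPolynomial.rename e.symm q, linear_approximates e ?_ ?_ ?_⟩
  · refine (MvPolynomial.continuous_eval _).measurable.comp (measurable_pi_iff.2 fun a => ?_)
    exact measurable_coordinate _ _
  · rw [heval]; exact hgm
  · rw [heval]; exact hg

/-- Networks in the last `K` inputs. -/
def pathNetworkSpan (σ : ℝ → ℝ) (K n : ℕ) : Submodule ℝ (PastPath n → ℝ) :=
  Submodule.span ℝ {g | ∃ (u : ℕ → Fin n → ℝ) (θ : ℝ), g = fun z => σ (pathFunctional K u z - θ)}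

theorem pathFunctional_smul (K : ℕ) (a : ℝ) (u : ℕ → Fin n → ℝ) (z : PastPath n) :
    pathFunctional K (a • u) z = a * pathFunctional K u z := by
  simp [pathFunctional, Finset.mul_sum, mul_assoc]

/-- Under the law of a path functional, the univariate cosine is a limit of networks in one
variable; composing with the functional yields networks on path space. -/
theorem exists_path_network_near (hp_top : p ≠ ⊤) {σ : ℝ → ℝ} {B : ℝ} (hσ : Measurable σ)
    (hB : ∀ s, |σ s| ≤ B) (hc : ¬ ∃ a : ℝ, ∀ᵐ s ∂(volume : Measure ℝ), σ s = a)
    {H : PastPath n → ℝ} (hH : MemLp H p μ) {ε : ℝ} (hε : 0 < ε) :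
    ∃ (K J : ℕ) (β θ : Fin J → ℝ) (u : Fin J → ℕ → Fin n → ℝ),
      eLpNorm (H - fun z => ∑ j, β j * σ (pathFunctional (K + 1) (u j) z - θ j)) p μ <
        ENNReal.ofReal ε := by
  obtain ⟨K, g, hg, -, hHg⟩ := exists_near_of_cos_mem hp_top
    (V := fun K => pathNetworkSpan σ (K + 1) n) (fun K u φ => by
      have h := lpClosure_comp (V := pathNetworkSpan σ (K + 1) n)
        (measurable_pathFunctional (K + 1) u) (fun g hg => ?_)
        (isNetworkLimit_cos hp_top hσ hB hc 1 (-φ) (μ.map (pathFunctional (K + 1) u)))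
      · convert h using 1
        ext z
        simp
      · induction hg using Submodule.span_induction with
        | mem g hg =>
          obtain ⟨a, b, rfl⟩ := hg
          refine Submodule.subset_span ⟨a • u, b, ?_⟩
          ext z
          simp [pathFunctional_smul]
        | zero => exact Submodule.zero_mem _
        | add f g _ _ hf hg => exact Submodule.add_mem _ hf hg
        | smul c f _ hf => exact Submodule.smul_mem _ c hf) hH hε
  obtain ⟨J, β, f, rfl⟩ := (Submodule.mem_span_set').1 hg
  choose u θ hu using fun j => (f j).2
  refine ⟨K, J, β, θ, u, ?_⟩
  convert hHg using 2
  ext z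
  simp [hu]

theorem exists_linear_network_approximates (hp_top : p ≠ ⊤) {σ : ℝ → ℝ} {B : ℝ}
    (hσ : Measurable σ) (hB : ∀ s, |σ s| ≤ B)
    (hc : ¬ ∃ a : ℝ, ∀ᵐ s ∂(volume : Measure ℝ), σ s = a)
    {H : PastPath n → ℝ} (hH : MemLp H p μ) {ε : ℝ} (hε : 0 < ε) :
    ∃ (N : ℕ) (A : Matrix (Fin N) (Fin N) ℝ) (c : Matrix (Fin N) (Fin n) ℝ)
      (h : (Fin N → ℝ) → ℝ), IsNeuralNetwork σ h ∧ (linear A c h).Approximates H p μ ε := by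
  obtain ⟨K, J, β, θ, u, hg⟩ := exists_path_network_near hp_top hσ hB hc hH hε
  let e : Fin ((K + 1) * n) ≃ Fin (K + 1) × Fin n := finProdFinEquiv.symm
  let α : Fin J → Fin ((K + 1) * n) → ℝ := fun j a => u j (e a).1 (e a).2
  have hα : ∀ j (z : PastPath n), (α j ⬝ᵥ fun a => z (NonposInt.ofNeg (e a).1) (e a).2) =
      pathFunctional (K + 1) (u j) z := fun j z => by
    rw [pathFunctional_eq_sum_window]
    exact e.sum_comp fun q => u j q.1 q.2 * pathWindow (K + 1) z q
  have hm : Measurable fun z : PastPath n =>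
      ∑ j, β j * σ (pathFunctional (K + 1) (u j) z - θ j) :=
    Finset.measurable_sum _ fun j _ =>
      (hσ.comp ((measurable_pathFunctional _ _).sub_const _)).const_mul _
  refine ⟨_, _, _, fun x => ∑ j, β j * σ (α j ⬝ᵥ x - θ j), ⟨J, β, θ, α, fun x => rfl⟩,
    linear_approximates e ?_ ?_ ?_⟩
  · simpa only [hα] using hm
  · simp only [hα]
    refine MemLp.of_bound hm.aestronglyMeasurable (∑ j, |β j| * B) (Eventually.of_forall fun z => ?_)
    refine (Finset.abs_sum_le_sum_abs _ _).trans (Finset.sum_le_sum fun j _ => ?_)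
    rw [abs_mul]
    exact mul_le_mul_of_nonneg_left (hB _) (abs_nonneg _)
  · simpa only [hα] using hg

end Families

/-! ### State-affine systems as cascades of rotations -/

section StateAffine

variable {n : ℕ}

open ReservoirSystem

/-- A matrix function is a trigonometric polynomial if its entries are trigonometric monomials. -/
theorem isTrigPolynomial_of_entries {N M : ℕ} {R : (Fin n → ℝ) → Matrix (Fin N) (Fin M) ℝ}
    (h : ∀ i j, ∃ (a b : ℝ) (u : Fin n → ℝ),
      ∀ z, R z i j = a * Real.cos (u ⬝ᵥ z) + b * Real.sin (u ⬝ᵥ z)) : IsTrigPolynomial R := by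
  choose a b u h using h
  let e : Fin (N * M) ≃ Fin N × Fin M := finProdFinEquiv.symm
  refine ⟨N * M, fun k => Matrix.single (e k).1 (e k).2 (a (e k).1 (e k).2),
    fun k => Matrix.single (e k).1 (e k).2 (b (e k).1 (e k).2), fun k => u (e k).1 (e k).2,
    fun k => u (e k).1 (e k).2, fun z => ?_⟩
  rw [e.sum_comp fun q => Real.cos (u q.1 q.2 ⬝ᵥ z) • Matrix.single q.1 q.2 (a q.1 q.2) +
    Real.sin (u q.1 q.2 ⬝ᵥ z) • Matrix.single q.1 q.2 (b q.1 q.2), Fintype.sum_prod_type]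
  ext i j
  simp only [Matrix.sum_apply, Matrix.add_apply, Matrix.smul_apply, Matrix.single_apply,
    smul_eq_mul]
  rw [Finset.sum_eq_single i, Finset.sum_eq_single j, h]
  · simp only [and_self, if_true]
    ring
  · intro l _ hl
    simp [hl]
  · simp
  · intro l _ hl
    simp [hl]
  · simp

/-- The cosine and the sine. -/
noncomputable def wave (s : Bool) (θ : ℝ) : ℝ := if s then Real.sin θ else Real.cos θ

/-- The entries of the rotation by `θ`. -/
noncomputable def rotationEntry : Bool → Bool → ℝ → ℝ
  | false, false => fun θ => Real.cos θ
  | false, true => fun θ => -Real.sin θ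
  | true, false => fun θ => Real.sin θ
  | true, true => fun θ => Real.cos θ

/-- Adding an angle acts linearly on the pair of cosine and sine, which is what lets a state-affine
system accumulate phases. -/
theorem sum_rotation_mul_wave (s : Bool) (θ θ' : ℝ) :
    ∑ s', rotationEntry s s' θ * wave s' θ' = wave s (θ + θ') := by
  cases s
  · simp [rotationEntry, wave, Real.cos_add]; ring
  · simp [rotationEntry, wave, Real.sin_add, add_comm]

/-- The phases accumulated by a cascade of rotations. -/
def phase (v : ℕ → Fin n → ℝ) (z : Signal n) : ℕ → ℤ → ℝ
  | 0, t => v 0 ⬝ᵥ z t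
  | k + 1, t => v (k + 1) ⬝ᵥ z t + phase v z k (t - 1)

theorem phase_eq_sum (v : ℕ → Fin n → ℝ) (z : Signal n) (k : ℕ) (t : ℤ) :
    phase v z k t = ∑ l ∈ Finset.range (k + 1), v (k - l) ⬝ᵥ z (t - l) := by
  induction k generalizing t with
  | zero => simp [phase]
  | succ k ih =>
    rw [phase, ih, Finset.sum_range_succ' _ (k + 1), add_comm]
    congr 1
    · refine Finset.sum_congr rfl fun l _ => ?_
      rw [Nat.add_sub_add_right, Nat.cast_succ, show t - 1 - (l : ℤ) = t - (l + 1) by ring]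
    · simp

/-- The input at time `-l` enters the phase at layer `K - l` and reaches layer `K` at time `0`, so
the weights are listed in reverse. -/
theorem phase_reverse_eq (u : ℕ → Fin n → ℝ) (K : ℕ) (z : PastPath n) :
    phase (fun l => u (K - l)) z.extend K 0 = pathFunctional (K + 1) u z := by
  rw [phase_eq_sum, pathFunctional]
  refine Finset.sum_congr rfl fun l hl => ?_
  rw [Finset.mem_range] at hl
  rw [PastPath.extend_neg, show K - (K - l) = l by omega]
  rfl

/-- The linear part of a family of cascades of rotations. -/
noncomputable def cascadeMatrix {J K : ℕ} (v : Fin J → ℕ → Fin n → ℝ) (z : Fin n → ℝ) :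
    Matrix (Fin J × Fin K × Bool) (Fin J × Fin K × Bool) ℝ :=
  fun a b => if a.1 = b.1 ∧ (b.2.1 : ℕ) + 1 = a.2.1 then rotationEntry a.2.2 b.2.2 (v a.1 a.2.1 ⬝ᵥ z)
    else 0

/-- The inhomogeneous part of a family of cascades of rotations. -/
noncomputable def cascadeInput {J K : ℕ} (v : Fin J → ℕ → Fin n → ℝ) (z : Fin n → ℝ)
    (a : Fin J × Fin K × Bool) : ℝ :=
  if (a.2.1 : ℕ) = 0 then wave a.2.2 (v a.1 0 ⬝ᵥ z) else 0

theorem cascade_isSolution {J K : ℕ} (v : Fin J → ℕ → Fin n → ℝ) (z : Signal n) (t : ℤ)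
    (a : Fin J × Fin K × Bool) :
    wave a.2.2 (phase (v a.1) z a.2.1 t) =
      (cascadeMatrix v (z t) *ᵥ fun b => wave b.2.2 (phase (v b.1) z b.2.1 (t - 1))) a +
        cascadeInput v (z t) a := by
  obtain ⟨j, ⟨k, hk⟩, s⟩ := a
  simp only [Matrix.mulVec, dotProduct, cascadeMatrix, cascadeInput, ite_mul, zero_mul,
    Fintype.sum_prod_type]
  rcases k with _ | k
  · simp [phase, dotProduct]
  · rw [Finset.sum_eq_single j, Finset.sum_eq_single ⟨k, by omega⟩]
    · simp only [and_self, if_true, phase, Nat.add_eq_zero_iff, one_ne_zero, and_false, if_false,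
        add_zero]
      exact (sum_rotation_mul_wave _ _ _).symm
    · rintro ⟨l, hl⟩ _ hne
      refine Finset.sum_eq_zero fun s' _ => if_neg ?_
      rintro ⟨-, h⟩
      exact hne (Fin.ext (by simp only at h ⊢; omega))
    · simp
    · intro i _ hi
      refine Finset.sum_eq_zero fun l _ => Finset.sum_eq_zero fun s' _ => if_neg ?_
      rintro ⟨h, -⟩
      exact hi h.symm
    · simp

theorem exists_stateAffine_approximates {p : ℝ≥0∞} [Fact (1 ≤ p)] {μ : Measure (PastPath n)}
    [IsFiniteMeasure μ] (hp_top : p ≠ ⊤) {H : PastPath n → ℝ} (hH : MemLp H p μ) {ε : ℝ}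
    (hε : 0 < ε) :
    ∃ (N : ℕ) (W : Fin N → ℝ) (P : (Fin n → ℝ) → Matrix (Fin N) (Fin N) ℝ)
      (Q : (Fin n → ℝ) → Matrix (Fin N) (Fin 1) ℝ),
      IsTrigPolynomial P ∧ IsTrigPolynomial Q ∧ (stateAffine W P Q).Approximates H p μ ε := by
  have hε0 : ENNReal.ofReal (ε / 2) ≠ 0 := by simpa using hε
  obtain ⟨J, K, a, φ, u, hT⟩ := exists_trigonometric_near hp_top hH hε0
  let v : Fin J → ℕ → Fin n → ℝ := fun j l => u j (K - l)
  let ι := Fin J × Fin (K + 1) × Bool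
  let e : Fin (Fintype.card ι) ≃ ι := (Fintype.equivFin ι).symm
  -- Only the last layer is read; its cosine and sine carry the weights `a * cos φ` and `-a * sin
  -- φ`, which produce `a * cos (phase + φ)`.
  let W : ι → ℝ := fun b => if b.2.1 = Fin.last K then
    if b.2.2 then -(a b.1 * Real.sin (φ b.1)) else a b.1 * Real.cos (φ b.1) else 0
  have hm : Measurable fun z : PastPath n =>
      ∑ j, a j * Real.cos (pathFunctional (K + 1) (u j) z + φ j) :=
    Finset.measurable_sum _ fun j _ =>
      (Real.measurable_cos.comp ((measurable_pathFunctional _ _).add_const _)).const_mul _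
  refine ⟨_, fun i => W (e i), fun z => (cascadeMatrix v z).submatrix e e,
    fun z i _ => cascadeInput v z (e i), isTrigPolynomial_of_entries fun i j => ?_,
    isTrigPolynomial_of_entries fun i j => ?_,
    IsRanked.approximates (ρ := fun i => (e i).2.1)
      (x := fun z t i => wave (e i).2.2 (phase (v (e i).1) z (e i).2.1 t))
      (fun x x' z i hxx' => ?_) (fun z t => ?_) (fun z => ?_) hm ?_
      (hT.trans_lt ((ENNReal.ofReal_lt_ofReal_iff hε).2 (by linarith)))⟩
  · simp only [Matrix.submatrix_apply, cascadeMatrix]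
    split_ifs
    · cases (e i).2.2 <;> cases (e j).2.2
      · exact ⟨1, 0, v (e i).1 (e i).2.1, fun z => by simp [rotationEntry]⟩
      · exact ⟨0, -1, v (e i).1 (e i).2.1, fun z => by simp [rotationEntry]⟩
      · exact ⟨0, 1, v (e i).1 (e i).2.1, fun z => by simp [rotationEntry]⟩
      · exact ⟨1, 0, v (e i).1 (e i).2.1, fun z => by simp [rotationEntry]⟩
    · exact ⟨0, 0, 0, by simp⟩
  · simp only [cascadeInput]
    split_ifs
    · cases (e i).2.2
      · exact ⟨1, 0, v (e i).1 0, fun z => by simp [wave]⟩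
      · exact ⟨0, 1, v (e i).1 0, fun z => by simp [wave]⟩
    · exact ⟨0, 0, 0, by simp⟩
  · simp only [stateAffine, Pi.add_apply]
    congr 1
    refine mulVec_apply_congr (ρ := fun i => ((e i).2.1 : ℕ)) (fun b hb => ?_) hxx'
    simp only [Matrix.submatrix_apply, cascadeMatrix] at hb
    have := (ite_ne_right_iff.1 hb).1.2
    omega
  · ext i
    simp only [stateAffine, Pi.add_apply]
    rw [cascade_isSolution v z t (e i)]
    congr 1
    simp only [Matrix.mulVec, dotProduct, Matrix.submatrix_apply]
    exact (e.sum_comp fun b => cascadeMatrix v (z t) (e i) b *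
      wave b.2.2 (phase (v b.1) z b.2.1 (t - 1))).symm
  · simp only [stateAffine, dotProduct]
    rw [e.sum_comp fun b => W b * wave b.2.2 (phase (v b.1) z.extend b.2.1 0),
      Fintype.sum_prod_type]
    refine Finset.sum_congr rfl fun j _ => ?_
    rw [Fintype.sum_prod_type, Finset.sum_eq_single (Fin.last K)]
    · simp only [W, Fintype.sum_bool, wave, if_true, Fin.val_last, Bool.false_eq_true, if_false]
      rw [show phase (v j) z.extend K 0 = _ from phase_reverse_eq (u j) K z, Real.cos_add]
      ring
    · intro l _ hl
      simp [W, hl]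
    · simp
  · refine MemLp.of_bound hm.aestronglyMeasurable (∑ j, |a j| * 1) (Eventually.of_forall fun z => ?_)
    refine (Finset.abs_sum_le_sum_abs _ _).trans (Finset.sum_le_sum fun j _ => ?_)
    rw [abs_mul]
    exact mul_le_mul_of_nonneg_left (Real.abs_cos_le_one _) (abs_nonneg _)

end StateAffine

/-! ### Echo state networks with approximate delay lines -/

section EchoStateNetwork

variable {n : ℕ}

open ReservoirSystem

/-- The neurons of a layered network: the delay layers, and the output layer. -/
abbrev LayerIndex (K n r J : ℕ) : Type := (Fin K × Fin n × Fin r) ⊕ Fin J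

/-- The recurrent weights of a layered network: the delay layer `k + 1` applies the network with
weights `a` and `c` to the components stored in the delay layer `k`, and the output layer has the
weights `α` with respect to the stored components. -/
def layerMatrix {K n r J : ℕ} (a c : Fin r → ℝ) (α : Fin J → ℕ → Fin n → ℝ) :
    Matrix (LayerIndex K n r J) (LayerIndex K n r J) ℝ
  | .inl q, .inl q' => if (q'.1 : ℕ) + 1 = q.1 ∧ q.2.1 = q'.2.1 then a q.2.2 * c q'.2.2 else 0
  | .inr j, .inl q' => α j (q'.1 + 1) q'.2.1 * c q'.2.2
  | _, .inr _ => 0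

/-- The input weights of a layered network. -/
def layerInput {K n r J : ℕ} (a : Fin r → ℝ) (α : Fin J → ℕ → Fin n → ℝ) :
    Matrix (LayerIndex K n r J) (Fin n) ℝ
  | .inl q, i => if (q.1 : ℕ) = 0 ∧ q.2.1 = i then a q.2.2 else 0
  | .inr j, i => α j 0 i

/-- The biases of a layered network. -/
def layerBias {K n r J : ℕ} (b : Fin r → ℝ) (θ : Fin J → ℝ) : LayerIndex K n r J → ℝ :=
  Sum.elim (fun q => -b q.2.2) fun j => -θ j

/-- The depth of a neuron. -/
def layerRank {K n r J : ℕ} : LayerIndex K n r J → ℕ :=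
  Sum.elim (fun q => q.1) fun _ => K

/-- The pre-activations of a layered network whose layers transmit the signal with distortion
`g`. -/
def layerPotential {K n r J : ℕ} (a b : Fin r → ℝ) (α : Fin J → ℕ → Fin n → ℝ) (θ : Fin J → ℝ)
    (g : ℝ → ℝ) (z : Signal n) (t : ℤ) : LayerIndex K n r J → ℝ :=
  Sum.elim (fun q => a q.2.2 * g^[q.1] (z (t - (q.1 : ℕ)) q.2.1) - b q.2.2)
    fun j => (∑ k ∈ Finset.range (K + 1), ∑ i, α j k i * g^[k] (z (t - k) i)) - θ j

theorem layerRank_lt_of_ne_zero {K n r J : ℕ} {a c : Fin r → ℝ} {α : Fin J → ℕ → Fin n → ℝ}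
    {x y : LayerIndex K n r J} (h : layerMatrix a c α x y ≠ 0) : layerRank y < layerRank x := by
  rcases x with q | j <;> rcases y with q' | j'
  · simp only [layerMatrix] at h
    have := (ite_ne_right_iff.1 h).1.1
    simp only [layerRank, Sum.elim_inl]
    omega
  · exact absurd rfl h
  · simp [layerRank]
  · exact absurd rfl h

/-- The outgoing weights `c` of delay layer `k` reassemble `g` from its neurons, so the next layer
receives `g^[k + 1]` of the input `k + 1` steps ago. The output layer takes lag `0` directly from
the input, undistorted, whence the index `q'.1 + 1` in its recurrent weights. -/
theorem layerPotential_eq {K n r J : ℕ} {a b c : Fin r → ℝ} (α : Fin J → ℕ → Fin n → ℝ)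
    (θ : Fin J → ℝ) {σ g : ℝ → ℝ} (hg : ∀ t, g t = ∑ l, c l * σ (a l * t - b l)) (z : Signal n)
    (t : ℤ) (x : LayerIndex K n r J) :
    layerPotential a b α θ g z t x =
      (layerMatrix a c α *ᵥ fun y => σ (layerPotential a b α θ g z (t - 1) y)) x +
        (layerInput a α *ᵥ z t) x + layerBias b θ x := by
  have hlayer : ∀ (k : ℕ) (i : Fin n), ∑ l, c l * σ (a l * g^[k] (z (t - 1 - k) i) - b l) =
      g^[k + 1] (z (t - (k + 1 : ℕ)) i) := fun k i => by
    rw [Function.iterate_succ_apply', hg, Nat.cast_succ, show t - 1 - (k : ℤ) = t - (k + 1) by ring]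
  rcases x with ⟨⟨k, hk⟩, i, l⟩ | j
  · simp only [Matrix.mulVec, dotProduct, Fintype.sum_sum_type, layerMatrix, layerInput, layerBias,
      layerPotential, Sum.elim_inl, Sum.elim_inr, ite_mul, zero_mul, Finset.sum_const_zero, add_zero,
      Fintype.sum_prod_type]
    rcases k with _ | k
    · simp [sub_eq_add_neg]
    · rw [Finset.sum_eq_single ⟨k, by omega⟩, Finset.sum_eq_single i]
      · simp only [and_self, if_true, Nat.add_eq_zero_iff, one_ne_zero, and_false, false_and,
          if_false, Finset.sum_const_zero, add_zero, mul_assoc, ← Finset.mul_sum, hlayer]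
        ring
      · intro i' _ hi'
        exact Finset.sum_eq_zero fun l' _ => if_neg fun h => hi' h.2.symm
      · simp
      · rintro ⟨k', hk'⟩ _ hne
        refine Finset.sum_eq_zero fun i' _ => Finset.sum_eq_zero fun l' _ => if_neg fun h => ?_
        exact hne (Fin.ext (by have := h.1; simp only at this ⊢; omega))
      · simp
  · simp only [Matrix.mulVec, dotProduct, Fintype.sum_sum_type, layerMatrix, layerInput, layerBias,
      layerPotential, Sum.elim_inl, Sum.elim_inr, zero_mul, Finset.sum_const_zero, add_zero,
      Fintype.sum_prod_type]
    rw [Finset.sum_range_succ', Finset.sum_range]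
    simp only [mul_assoc, ← Finset.mul_sum, hlayer]
    simp [sub_eq_add_neg]

/-- Networks in distorted versions of the last inputs are functionals of echo state networks. -/
theorem exists_echoStateNetwork_of_distortion {σ g : ℝ → ℝ} (hg : g ∈ networkSpan σ) {K J : ℕ}
    (β θ : Fin J → ℝ) (u : Fin J → ℕ → Fin n → ℝ) {p : ℝ≥0∞} {μ : Measure (PastPath n)}
    {H G : PastPath n → ℝ} {ε : ℝ}
    (hG : ∀ z, G z = ∑ j, β j * σ ((∑ k ∈ Finset.range (K + 1),
      ∑ i, u j k i * g^[k] (z (NonposInt.ofNeg k) i)) - θ j))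
    (hGm : Measurable G) (hGp : MemLp G p μ) (hε : eLpNorm (H - G) p μ < ENNReal.ofReal ε) :
    ∃ (N : ℕ) (A : Matrix (Fin N) (Fin N) ℝ) (C : Matrix (Fin N) (Fin n) ℝ)
      (ζ W : Fin N → ℝ), (echoStateNetwork σ A C ζ W).Approximates H p μ ε := by
  obtain ⟨r, c, f, rfl⟩ := (Submodule.mem_span_set').1 hg
  choose a b hab using fun l => (f l).2
  set g : ℝ → ℝ := ∑ l, c l • (f l : ℝ → ℝ) with hg_def
  have hg' : ∀ t, g t = ∑ l, c l * σ (a l * t - b l) := fun t => by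
    simp [hg_def, hab]
  let ι := LayerIndex K n r J
  let e : Fin (Fintype.card ι) ≃ ι := (Fintype.equivFin ι).symm
  refine ⟨_, (layerMatrix a c u).submatrix e e, (layerInput a u).submatrix e id,
    fun i => layerBias b θ (e i), fun i => Sum.elim (fun _ => 0) β (e i),
    IsRanked.approximates (ρ := fun i => layerRank (e i))
      (x := fun z t i => σ (layerPotential a b u θ g z t (e i)))
      (fun x x' z i hxx' => ?_) (fun z t => ?_) (fun z => ?_) hGm hGp hε⟩
  · simp only [echoStateNetwork, Pi.add_apply]
    congr 3
    exact mulVec_apply_congr (ρ := fun i => layerRank (e i))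
      (fun y hy => layerRank_lt_of_ne_zero hy) hxx'
  · ext i
    simp only [echoStateNetwork, Pi.add_apply]
    rw [layerPotential_eq u θ hg' z t (e i)]
    congr 3
    simp only [Matrix.mulVec, dotProduct, Matrix.submatrix_apply]
    exact (e.sum_comp fun y => layerMatrix a c u (e i) y *
      σ (layerPotential a b u θ g z (t - 1) y)).symm
  · simp only [echoStateNetwork, dotProduct]
    rw [e.sum_comp fun y => Sum.elim (fun _ => 0) β y * σ (layerPotential a b u θ g z.extend 0 y),
      Fintype.sum_sum_type, hG]
    simp only [Sum.elim_inl, Sum.elim_inr, zero_mul, Finset.sum_const_zero, zero_add,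
      layerPotential, PastPath.extend_neg]

theorem continuous_of_mem_networkSpan {σ g : ℝ → ℝ} (hσ : Continuous σ) (hg : g ∈ networkSpan σ) :
    Continuous g := by
  induction hg using Submodule.span_induction with
  | mem g hg =>
    obtain ⟨a, b, rfl⟩ := hg
    fun_prop
  | zero => exact continuous_const
  | add f g _ _ hf hg => exact hf.add hg
  | smul c f _ hf => exact hf.const_smul c

/-- A static network `T` in the last inputs is fixed first, and lag `k` is then distorted by `(g
m)^[k]`. As `m` grows the distorted networks converge pointwise to `T` by continuity of `σ`, under
the uniform bound `∑ |β j| * B`, hence in `L^p`. -/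
theorem exists_echoStateNetwork_approximates {p : ℝ≥0∞} [hp : Fact (1 ≤ p)]
    {μ : Measure (PastPath n)} [IsFiniteMeasure μ] (hp_top : p ≠ ⊤) {σ : ℝ → ℝ} {B : ℝ}
    (hσ : Continuous σ) (hB : ∀ s, |σ s| ≤ B) (hc : ¬ ∃ a : ℝ, ∀ s, σ s = a)
    {H : PastPath n → ℝ} (hH : MemLp H p μ) {ε : ℝ} (hε : 0 < ε) :
    ∃ (N : ℕ) (A : Matrix (Fin N) (Fin N) ℝ) (C : Matrix (Fin N) (Fin n) ℝ)
      (ζ W : Fin N → ℝ), (echoStateNetwork σ A C ζ W).Approximates H p μ ε := by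
  have hε2 : 0 < ε / 2 := half_pos hε
  obtain ⟨K, J, β, θ, u, hT⟩ := exists_path_network_near hp_top hσ.measurable hB
    (not_ae_const_of_continuous hσ hc) hH hε2
  obtain ⟨g, hg, hgid⟩ := exists_network_iterate_tendsto_id hσ hB hc
  let G : ℕ → PastPath n → ℝ := fun m z => ∑ j, β j * σ ((∑ k ∈ Finset.range (K + 1),
      ∑ i, u j k i * (g m)^[k] (z (NonposInt.ofNeg k) i)) - θ j)
  have hGm : ∀ m, Measurable (G m) := fun m => by
    refine Finset.measurable_sum _ fun j _ => (hσ.measurable.comp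
      ((Finset.measurable_sum _ fun k _ => Finset.measurable_sum _ fun i _ => ?_).sub_const
        _)).const_mul _
    exact (((continuous_of_mem_networkSpan hσ (hg m)).iterate k).measurable.comp
      (measurable_coordinate _ _)).const_mul _
  have hGB : ∀ m z, |G m z| ≤ ∑ j, |β j| * B := fun m z => by
    refine (Finset.abs_sum_le_sum_abs _ _).trans (Finset.sum_le_sum fun j _ => ?_)
    rw [abs_mul]
    exact mul_le_mul_of_nonneg_left (hB _) (abs_nonneg _)
  have hlim : ∀ z, Tendsto (fun m => G m z) atTop
      (𝓝 (∑ j, β j * σ (pathFunctional (K + 1) (u j) z - θ j))) := fun z => by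
    refine tendsto_finsetSum _ fun j _ => ((hσ.tendsto _).comp (Tendsto.sub_const
      (tendsto_finsetSum _ fun k _ => tendsto_finsetSum _ fun i _ => ?_) _)).const_mul _
    exact (hgid k _).const_mul _
  obtain ⟨hTp, hconv⟩ := tendsto_eLpNorm_sub_of_dominated (μ := μ) hp_top
    (fun m => (hGm m).aestronglyMeasurable) (memLp_const _) hGB hlim
  set T : PastPath n → ℝ := fun z => ∑ j, β j * σ (pathFunctional (K + 1) (u j) z - θ j)
  obtain ⟨m, hm⟩ := (hconv.eventually (gt_mem_nhds (ENNReal.ofReal_pos.2 hε2))).exists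
  have hGp : MemLp (G m) p μ :=
    MemLp.of_bound (hGm m).aestronglyMeasurable _ (Eventually.of_forall (hGB m))
  refine exists_echoStateNetwork_of_distortion (hg m) β θ u (fun z => rfl) (hGm m) hGp ?_
  rw [show H - G m = (H - T) + (T - G m) by abel]
  calc _ ≤ _ := eLpNorm_add_le (hH.sub hTp).1 (hTp.sub hGp).1 hp.out
    _ < ENNReal.ofReal (ε / 2) + ENNReal.ofReal (ε / 2) :=
      ENNReal.add_lt_add hT (by rwa [eLpNorm_sub_comm])
    _ = ENNReal.ofReal ε := by rw [← ENNReal.ofReal_add hε2.le hε2.le, add_halves]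

end EchoStateNetwork

/-! ### The main theorem -/

theorem theorem3 (n : ℕ) (p : ℝ≥0∞) (hp_one : 1 ≤ p) (hp_top : p ≠ ⊤)
    (H : PastPath n → ℝ) (hH : Measurable H)
    (μ : Measure (PastPath n)) [IsProbabilityMeasure μ] (hHp : MemLp H p μ)
    (ε : ℝ) (hε : 0 < ε) :
    -- some reservoir system approximates `H`
    (∃ (N : ℕ) (S : ReservoirSystem n N), S.Approximates H p μ ε) ∧
    -- linear reservoirs with polynomial readout
    (HasExponentialMoments μ →
      ∃ (N : ℕ) (A : Matrix (Fin N) (Fin N) ℝ) (c : Matrix (Fin N) (Fin n) ℝ)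
        (h : MvPolynomial (Fin N) ℝ),
        (ReservoirSystem.linear A c (fun x => MvPolynomial.eval x h)).Approximates H p μ ε) ∧
    -- linear reservoirs with neural network readout
    (∀ σ : ℝ → ℝ, Measurable σ → (∃ B : ℝ, ∀ s, |σ s| ≤ B) →
      (¬ ∃ a : ℝ, ∀ᵐ s ∂(volume : Measure ℝ), σ s = a) →
      ∃ (N : ℕ) (A : Matrix (Fin N) (Fin N) ℝ) (c : Matrix (Fin N) (Fin n) ℝ)
        (h : (Fin N → ℝ) → ℝ), IsNeuralNetwork σ h ∧
        (ReservoirSystem.linear A c h).Approximates H p μ ε) ∧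
    -- trigonometric state-affine systems with linear readout
    (∃ (N : ℕ) (W : Fin N → ℝ) (P : (Fin n → ℝ) → Matrix (Fin N) (Fin N) ℝ)
        (Q : (Fin n → ℝ) → Matrix (Fin N) (Fin 1) ℝ),
        IsTrigPolynomial P ∧ IsTrigPolynomial Q ∧
        (ReservoirSystem.stateAffine W P Q).Approximates H p μ ε) ∧
    -- echo state networks with linear readout
    (∀ σ : ℝ → ℝ, Continuous σ → (∃ B : ℝ, ∀ s, |σ s| ≤ B) → (¬ ∃ a : ℝ, ∀ s, σ s = a) →
      ∃ (N : ℕ) (A : Matrix (Fin N) (Fin N) ℝ) (C : Matrix (Fin N) (Fin n) ℝ)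
        (ζ W : Fin N → ℝ),
        (ReservoirSystem.echoStateNetwork σ A C ζ W).Approximates H p μ ε) := by
  have : Fact (1 ≤ p) := ⟨hp_one⟩
  -- The state-affine family needs no condition on `μ` and no activation function, so it also
  -- settles the plain existence claim.
  obtain ⟨N, W, P, Q, hP, hQ, hS⟩ := exists_stateAffine_approximates hp_top hHp hε
  exact ⟨⟨N, _, hS⟩, fun hμ => exists_linear_polynomial_approximates hp_top hμ hHp hε,
    fun σ hσ ⟨B, hB⟩ hc => exists_linear_network_approximates hp_top hσ hB hc hHp hε,
    ⟨N, W, P, Q, hP, hQ, hS⟩,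
    fun σ hσ ⟨B, hB⟩ hc => exists_echoStateNetwork_approximates hp_top hσ hB hc hHp hε⟩
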